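/- Let $J^+,J^-$ be finite index sets, $J=J^+\cup J^-$ (disjoint), let $\mathcal B=(\mathcal B_{ij})_{i,j\in J}$ be an arbitrary complex matrix and $1\le p<\infty$. Let $\mathbf X_p=(L^p(0,1))^{J}$ (complex valued functions) with norm $\|f\|=(\sum_{j\in J}\|f_j\|_{L^p}^p)^{1/p}$, and write its elements as $\binom{\upsilon}{\varpi}$ with $\upsilon=(\upsilon_j)_{j\in J^+}$, $\varpi=(\varpi_j)_{j\in J^-}$. Let $A\binom{\upsilon}{\varpi}=\binom{-\upsilon'}{\varpi'}$ be the operator in $\mathbf X_p$ with domain $$D(A)=\Big\{\tbinom{\upsilon}{\varpi}\in (W^{1,p}(0,1))^{J}:\ \tbinom{\upsilon(0)}{\varpi(1)}=\mathcal B\tbinom{\upsilon(1)}{\varpi(0)}\Big\}$$ (the transport system on a network with unit velocities and without zero-order term). This operator generates a $C_0$-semigroup $(G(t))_{t\ge0}$ on $\mathbf X_p$. Let $\lambda_1,\dots,\lambda_k$ be the distinct eigenvalues of $\mathcal B$, let $\alpha_j$ be the algebraic multiplicity of $\lambda_j$ and let $\Pi_j$ be the spectral projection of $\mathcal B$ onto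 the generalized eigenspace of $\lambda_j$. Put $$\mathcal p_j(n)=\sum_{r=0}^{\alpha_j-1}\binom nr\lambda_j^{-r}(\mathcal B-\lambda_jI)^r,$$ a matrix polynomial in $n$ of degree less than $\alpha_j$, so that $\mathcal B^n\Pi_j=\lambda_j^n\mathcal p_j(n)\Pi_j$; if $\lambda_j=0$, the symbol $\lambda_j^n\mathcal p_j(n)$ stands for $\mathcal B^n$. Let $\mathcal V\binom{\upsilon}{\varpi}(x)=\binom{\upsilon(x)}{\varpi(1-x)}$, let matrices act on $\mathbf X_p$ pointwise, and write $M^{11},M^{12},M^{21},M^{22}$ for the blocks of a matrix $M$ with respect to $J=J^+\cup J^-$. Let $0\le d\le k$ and assume that $|\lambda_j|<1$ for $j=d+1,\dots,k$. Put $$Z^1=\mathcal V\Big(\sum_{j=1}^d\Pi_j\Big)\mathcal V\,\mathbf X_p,\qquad Z^2=\mathcal V\Big(\sum_{j=d+1}^k\Pi_j\Big)\mathcal V\,\mathbf X_p .$$ Then $Z^1$ and $Z^2$ are closed subspaces, invariant under $(G(t))_{t\ge0}$, and $\mathbf X_p=Z^1\oplus Z^2$. Let $G^1(t)$ be the operator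 on $\mathbf X_p$ that equals $G(t)$ on $Z^1$ and $0$ on $Z^2$. The operators $G^1(t)$ are bounded, $G^1(s+t)=G^1(s)G^1(t)$ for all $s,t\ge0$, and $$\lim_{t\to\infty}\|G(t)-G^1(t)\|=0$$ in the operator norm of $\mathbf X_p$. For all $t\ge0$, $\Phi=\binom{\upsilon}{\varpi}\in\mathbf X_p$, $n\in\mathbb N_0$ and almost all $x\in(0,1)$, $$(G^1(t)\Phi)^+(x)=\sum_{j=1}^d\lambda_j^n\Big((\mathcal p_j(n)\Pi_j)^{11}\upsilon(n-t+x)+(\mathcal p_j(n)\Pi_j)^{12}\varpi(1-n+t-x)\Big)$$ if $n-1+x<t<n+x$, and $$(G^1(t)\Phi)^-(x)=\sum_{j=1}^d\lambda_j^n\Big((\mathcal p_j(n)\Pi_j)^{21}\upsilon(1-t+n-x)+(\mathcal p_j(n)\Pi_j)^{22}\varpi(t-n+x)\Big)$$ if $n-x<t<n+1-x$. If, in addition, $d\ge1$ and the eigenvalues $\lambda_1,\dots,\lambda_d$ are semisimple with $\lambda_j=e^{2\pi i(j-1)/d}$ for $j=1,\dots,d$, then $(G^1(t))_{t\ge0}$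 is periodic with period $d$, that is, $d$ is the least $T>0$ with $G^1(t+T)=G^1(t)$ for all $t\ge0$, and the two formulas hold with $\lambda_j^n\mathcal p_j(n)\Pi_j$ replaced by $e^{2\pi i(j-1)n/d}\,\Pi_j$. -/

import Mathlib

open MeasureTheory Set Filter Topology
open scoped ENNReal NNReal ContDiff

noncomputable section

namespace NetworkTransport

/-! ### The state space -/

/-- Lebesgue measure on the unit interval `(0,1)`. -/
abbrev unitVol : Measure ℝ := volume.restrict (Ioo (0 : ℝ) 1)

/-- The space `(L^p(0,1))^J` of complex functions with the norm
`(∑ j, ‖f j‖_p ^ p) ^ (1/p)`; for `J = Jp ⊕ Jm` the components indexed by `Jp` flow from `0` to `1`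
and those indexed by `Jm` flow from `1` to `0`. -/
abbrev XSpace (p : ℝ≥0∞) (J : Type*) : Type _ := PiLp p (fun _ : J => Lp ℂ p unitVol)

/-! ### Semigroups and generators -/

/-- `(G(t))_{t ≥ 0}` is a strongly continuous semigroup of bounded operators on `E`. -/
structure IsC0Semigroup {E : Type*} [NormedAddCommGroup E] [NormedSpace ℂ E]
    (G : ℝ≥0 → E →L[ℂ] E) : Prop where
  map_zero : G 0 = ContinuousLinearMap.id ℂ E
  map_add : ∀ s t : ℝ≥0, G (s + t) = (G s).comp (G t)
  continuous : ∀ f : E, Continuous fun t : ℝ≥0 => G t f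

/-- The (possibly unbounded) operator with graph `{(f, g) | A f g}` is the generator of the
strongly continuous semigroup `G`: one has `f ∈ D(A)` and `A f = g` exactly when
`(G(h) f - f) / h → g` as `h → 0+`. -/
def Generates {E : Type*} [NormedAddCommGroup E] [NormedSpace ℂ E]
    (A : E → E → Prop) (G : ℝ≥0 → E →L[ℂ] E) : Prop :=
  IsC0Semigroup G ∧ ∀ f g : E, A f g ↔
    Tendsto (fun h : ℝ≥0 => (((h : ℝ) : ℂ))⁻¹ • (G h f - f)) (𝓝[>] 0) (𝓝 g)

/-! ### The operator of the transport problem with unit velocities -/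

/-- `v` is the weak derivative of `u` on `(0,1)`. -/
def HasWeakDeriv (u v : ℝ → ℂ) : Prop :=
  ∀ φ : ℝ → ℝ, ContDiff ℝ ∞ φ → HasCompactSupport φ → tsupport φ ⊆ Ioo 0 1 →
    ∫ x in Ioo (0 : ℝ) 1, deriv φ x • u x = - ∫ x in Ioo (0 : ℝ) 1, φ x • v x

/-- `U` is a representative of `u` that is continuous on `[0,1]`; its values at `0` and `1` are the
boundary values of `u`. -/
def IsContinuousRep (U u : ℝ → ℂ) : Prop :=
  ContinuousOn U (Icc 0 1) ∧ U =ᵐ[unitVol] u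

/-- The graph of the operator `A f = (-f⁺', f⁻')` on the domain of all `f = (υ, ϖ)` with components
in `W^{1,p}(0,1)` such that `(υ(0), ϖ(1)) = B (υ(1), ϖ(0))`: the proposition says that `f` lies in
this domain and that `A f = g`. -/
def transportGraph {Jp Jm : Type*} [Fintype Jp] [Fintype Jm] (p : ℝ≥0∞)
    (B : Matrix (Jp ⊕ Jm) (Jp ⊕ Jm) ℂ) (f g : XSpace p (Jp ⊕ Jm)) : Prop :=
  (∀ i : Jp, HasWeakDeriv (f (Sum.inl i)) (-(g (Sum.inl i)))) ∧
  (∀ i : Jm, HasWeakDeriv (f (Sum.inr i)) (g (Sum.inr i))) ∧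
  ∃ U : Jp ⊕ Jm → ℝ → ℂ, (∀ j, IsContinuousRep (U j) (f j)) ∧
    Sum.elim (fun i => U (Sum.inl i) 0) (fun i => U (Sum.inr i) 1) =
      B.mulVec (Sum.elim (fun i => U (Sum.inl i) 1) (fun i => U (Sum.inr i) 0))

/-! ### Spectral data of a matrix -/

section Spectral

variable {J : Type*} [Fintype J] [DecidableEq J]

/-- The generalized eigenspace of `B` for `μ`. -/
abbrev genEig (B : Matrix J J ℂ) (μ : ℂ) : Submodule ℂ (J → ℂ) :=
  Module.End.maxGenEigenspace (Matrix.toLin' B) μ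

theorem isCompl_genEig (B : Matrix J J ℂ) (μ : ℂ) :
    IsCompl (genEig B μ) (⨆ ν : ℂ, ⨆ _ : ν ≠ μ, genEig B ν) := by
  refine ⟨(Module.End.independent_maxGenEigenspace (Matrix.toLin' B)) μ, ?_⟩
  rw [codisjoint_iff, eq_top_iff, ← Module.End.iSup_maxGenEigenspace_eq_top (Matrix.toLin' B)]
  refine iSup_le fun ν => ?_
  by_cases h : ν = μ
  · subst h
    exact le_sup_left
  · exact le_sup_of_le_right (le_iSup₂_of_le ν h le_rfl)

/-- The spectral projection of `B` for `μ`: the projection onto the generalized eigenspace of `μ`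
along the sum of all the other generalized eigenspaces. -/
def specProj (B : Matrix J J ℂ) (μ : ℂ) : Matrix J J ℂ :=
  LinearMap.toMatrix' (Submodule.projection _ _ (isCompl_genEig B μ))

/-- The algebraic multiplicity of `μ` as an eigenvalue of `B`. -/
def algMult (B : Matrix J J ℂ) (μ : ℂ) : ℕ := B.charpoly.rootMultiplicity μ

/-- The eigenvalue `μ` of `B` is semisimple. -/
def IsSemisimpleEigenvalue (B : Matrix J J ℂ) (μ : ℂ) : Prop :=
  genEig B μ = Module.End.eigenspace (Matrix.toLin' B) μ

/-- For `μ ≠ 0`, the value at `n` of the matrix polynomial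
`p(n) = ∑ r < α, (n choose r) μ^(-r) (B - μ)^r`, of degree `< α`, where `α` is the algebraic
multiplicity of `μ`. -/
def polyPart (B : Matrix J J ℂ) (μ : ℂ) (n : ℕ) : Matrix J J ℂ :=
  ∑ r ∈ Finset.range (algMult B μ), ((n.choose r : ℂ) * (μ⁻¹) ^ r) • (B - μ • 1) ^ r

/-- The matrix `μ^n p(n)`, by which `B^n` acts on the generalized eigenspace of `μ`. For `μ = 0`
this stands for `B^n`. -/
def powPart (B : Matrix J J ℂ) (μ : ℂ) (n : ℕ) : Matrix J J ℂ :=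
  if μ = 0 then B ^ n else μ ^ n • polyPart B μ n

end Spectral

/-! ### Invariant subspaces -/

section Subspaces

variable {Jp Jm : Type*} [Fintype Jp] [Fintype Jm] (p : ℝ≥0∞)

/-- The action of a matrix on `(L^p(0,1))^J`. -/
def matAct {J : Type*} [Fintype J] (M : Matrix J J ℂ) : XSpace p J →ₗ[ℂ] XSpace p J where
  toFun f := WithLp.toLp p fun i => ∑ j, M i j • f j
  map_add' f g := PiLp.ext fun i => by
    change ∑ j, M i j • (f j + g j) = ∑ j, M i j • f j + ∑ j, M i j • g j
    rw [← Finset.sum_add_distrib]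
    exact Finset.sum_congr rfl fun j _ => smul_add _ _ _
  map_smul' c f := PiLp.ext fun i => by
    change ∑ j, M i j • (c • f j) = c • ∑ j, M i j • f j
    rw [Finset.smul_sum]
    exact Finset.sum_congr rfl fun j _ => smul_comm _ _ _

theorem measurePreserving_reflect :
    MeasurePreserving (fun x : ℝ => 1 - x) unitVol unitVol := by
  have h := (volume.measurePreserving_sub_left (1 : ℝ)).restrict_preimage
    (measurableSet_Ioo (a := (0 : ℝ)) (b := 1))
  simpa using h

/-- The map `V (υ, ϖ)(x) = (υ(x), ϖ(1 - x))`. -/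
def reflect : XSpace p (Jp ⊕ Jm) →ₗ[ℂ] XSpace p (Jp ⊕ Jm) where
  toFun f := WithLp.toLp p (Sum.elim (fun i => f (Sum.inl i)) (fun i =>
    Lp.compMeasurePreservingₗ ℂ (fun x : ℝ => 1 - x) measurePreserving_reflect (f (Sum.inr i))))
  map_add' f g := PiLp.ext fun i => by
    rcases i with i | i
    · rfl
    · exact map_add (Lp.compMeasurePreservingₗ ℂ (fun x : ℝ => 1 - x) measurePreserving_reflect)
        (f (Sum.inr i)) (g (Sum.inr i))
  map_smul' c f := PiLp.ext fun i => by
    rcases i with i | i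
    · rfl
    · exact map_smul (Lp.compMeasurePreservingₗ ℂ (fun x : ℝ => 1 - x) measurePreserving_reflect)
        c (f (Sum.inr i))

/-- The subspace `{V Q V f}` of `(L^p(0,1))^(Jp ⊕ Jm)` for a matrix `Q`. -/
def reflectedRange (Q : Matrix (Jp ⊕ Jm) (Jp ⊕ Jm) ℂ) : Submodule ℂ (XSpace p (Jp ⊕ Jm)) :=
  LinearMap.range (reflect p ∘ₗ matAct p Q ∘ₗ reflect p)

end Subspaces

/-- The values at `x` of the components of `f` with index in `Jp`. -/
def plusAt {Jp Jm : Type*} {p : ℝ≥0∞} (f : XSpace p (Jp ⊕ Jm)) (x : ℝ) : Jp → ℂ :=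
  fun i => f (Sum.inl i) x

/-- The values at `x` of the components of `f` with index in `Jm`. -/
def minusAt {Jp Jm : Type*} {p : ℝ≥0∞} (f : XSpace p (Jp ⊕ Jm)) (x : ℝ) : Jm → ℂ :=
  fun i => f (Sum.inr i) x

/-- The block formula for a family of operators `H(t)`, `t ≥ 0`, with coefficient matrices `C n j`
(`n ∈ ℕ`, `j < d`): for every `t ≥ 0`, every `f = (υ, ϖ)` and every `n`, for almost all `x ∈ (0,1)`,
`(H(t) f)⁺(x) = ∑ j, ((C n j)¹¹ υ(n - t + x) + (C n j)¹² ϖ(1 - n + t - x))`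
if `n - 1 + x < t < n + x`, and
`(H(t) f)⁻(x) = ∑ j, ((C n j)²¹ υ(1 - t + n - x) + (C n j)²² ϖ(t - n + x))`
if `n - x < t < n + 1 - x`. -/
def HasBlockFormula {Jp Jm : Type*} [Fintype Jp] [Fintype Jm] {p : ℝ≥0∞} [Fact (1 ≤ p)] {d : ℕ}
    (C : ℕ → Fin d → Matrix (Jp ⊕ Jm) (Jp ⊕ Jm) ℂ)
    (H : ℝ≥0 → XSpace p (Jp ⊕ Jm) →L[ℂ] XSpace p (Jp ⊕ Jm)) : Prop :=
  ∀ (t : ℝ≥0) (f : XSpace p (Jp ⊕ Jm)) (n : ℕ), ∀ᵐ x : ℝ ∂unitVol,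
    (((n : ℝ) - 1 + x < (t : ℝ) ∧ (t : ℝ) < (n : ℝ) + x) →
      plusAt (H t f) x =
        ∑ j, ((C n j).toBlocks₁₁.mulVec (plusAt f ((n : ℝ) - (t : ℝ) + x)) +
          (C n j).toBlocks₁₂.mulVec (minusAt f (1 - (n : ℝ) + (t : ℝ) - x)))) ∧
    (((n : ℝ) - x < (t : ℝ) ∧ (t : ℝ) < (n : ℝ) + 1 - x) →
      minusAt (H t f) x =
        ∑ j, ((C n j).toBlocks₂₁.mulVec (plusAt f (1 - (t : ℝ) + (n : ℝ) - x)) +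
          (C n j).toBlocks₂₂.mulVec (minusAt f ((t : ℝ) - (n : ℝ) + x))))

end NetworkTransport

end

open NetworkTransport

/-! The involution `reflect` reverses the components indexed by `Jm`, so that every component flows
from 0 to 1 and the boundary condition reads f(0) = B f(1). This problem is solved along
characteristics: for almost every x there is exactly one n with x + n - t in (0,1), and then
(T(t)f)(x) = B^n f(x + n - t), where n counts the passages through the boundary. The operators T(t)
are `transport`, and their semigroup law is B^m B^n = B^(m+n).

That T has the right generator is shown through an integrated equation (`IntegratedEq`): f = c - ∫₀ˣ
g and c = B(c - ∫₀¹ g). By `isGenPair_transport_iff` it describes the generator of T, and by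
`integratedEq_iff` it is the weak differential equation with its boundary condition. A semigroup is
determined by its generator (`eq_of_isGenPair_imp`), so every G in the theorem is the conjugate of T
by the reflection.

The rest is linear algebra. Constant matrices commute with translations, and spectral projections
commute with B. Hence P1, the sum of the first d projections, and P2 = 1 - P1 commute with T(t) and
split the space; G¹ is the conjugate of P1 T(t). The difference G - G¹ is the conjugate of P2 T(t).
Since T(n) = B^n, T is bounded on [0,1] and P2 B^n → 0, it tends to 0 in norm. The block formula is
the characteristic formula combined with `pow_mul_specProj`, which is the binomial expansion of B^n
on a generalized eigenspace.

In the periodic case P1 B^d = P1 makes d a period. No smaller period exists: testing on v ⊗ x, with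
v an eigenvector for a primitive d-th root of unity, forces a period to be an integer multiple of d.
-/

noncomputable section

namespace NetworkTransport

/-! ### Spectral projections and powers of the boundary matrix -/

section SpectralLemmas

variable {J : Type*} [Fintype J] [DecidableEq J] (B : Matrix J J ℂ)

theorem specProj_mulVec_self {μ : ℂ} {v : J → ℂ} (hv : v ∈ genEig B μ) :
    (specProj B μ).mulVec v = v := by
  rw [specProj, LinearMap.toMatrix'_mulVec]
  exact Submodule.projection_apply_of_mem_left _ hv

theorem specProj_mulVec_of_ne {μ ν : ℂ} (h : ν ≠ μ) {v : J → ℂ} (hv : v ∈ genEig B ν) :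
    (specProj B μ).mulVec v = 0 := by
  rw [specProj, LinearMap.toMatrix'_mulVec, Submodule.projection_apply_eq_zero_iff]
  exact (le_iSup₂_of_le (f := fun ν (_ : ν ≠ μ) => genEig B ν) ν h le_rfl) hv

theorem specProj_mulVec_mem (μ : ℂ) (v : J → ℂ) : (specProj B μ).mulVec v ∈ genEig B μ := by
  rw [specProj, LinearMap.toMatrix'_mulVec]
  exact Submodule.projection_apply_mem _ v

/-- Two matrices agree if they agree on all generalized eigenspaces of `B`. -/
theorem matrix_ext_genEig {M N : Matrix J J ℂ}
    (h : ∀ ν : ℂ, ∀ v ∈ genEig B ν, M.mulVec v = N.mulVec v) : M = N := by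
  have key : (⊤ : Submodule ℂ (J → ℂ)) ≤
      LinearMap.eqLocus (Matrix.toLin' M) (Matrix.toLin' N) := by
    rw [← Module.End.iSup_maxGenEigenspace_eq_top (Matrix.toLin' B)]
    refine iSup_le fun ν v hv => ?_
    simpa using h ν v hv
  exact Matrix.toLin'.injective (LinearMap.ext fun w => key (Submodule.mem_top (x := w)))

theorem mulVec_mem_genEig {ν : ℂ} {v : J → ℂ} (hv : v ∈ genEig B ν) :
    B.mulVec v ∈ genEig B ν :=
  Module.End.mapsTo_maxGenEigenspace_of_comm (Commute.refl (Matrix.toLin' B)) ν hv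

theorem specProj_mul_of_ne {μ ν : ℂ} (h : ν ≠ μ) : specProj B μ * specProj B ν = 0 := by
  refine matrix_ext_genEig B fun κ v hv => ?_
  rw [← Matrix.mulVec_mulVec, specProj_mulVec_of_ne B h (specProj_mulVec_mem B ν v),
    Matrix.zero_mulVec]

theorem commute_specProj (μ : ℂ) : Commute (specProj B μ) B := by
  refine matrix_ext_genEig B fun ν v hv => ?_
  rw [← Matrix.mulVec_mulVec, ← Matrix.mulVec_mulVec]
  by_cases h : ν = μ
  · subst h
    rw [specProj_mulVec_self B hv, specProj_mulVec_self B (mulVec_mem_genEig B hv)]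
  · rw [specProj_mulVec_of_ne B h hv, specProj_mulVec_of_ne B h (mulVec_mem_genEig B hv),
      Matrix.mulVec_zero]

theorem genEig_eq_bot {μ : ℂ} (h : μ ∉ spectrum ℂ B) : genEig B μ = ⊥ := by
  by_contra hne
  apply h
  rw [← Matrix.spectrum_toLin']
  refine Module.End.HasEigenvalue.mem_spectrum ?_
  have hu : Module.End.HasUnifEigenvalue (Matrix.toLin' B) μ ⊤ := hne
  exact (Module.End.hasUnifEigenvalue_iff_hasUnifEigenvalue_one (by simp)).1 hu

theorem sum_specProj {ι : Type*} [Fintype ι] {lam : ι → ℂ} (hinj : Function.Injective lam)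
    (hspec : Set.range lam = spectrum ℂ B) : ∑ j, specProj B (lam j) = 1 := by
  classical
  refine matrix_ext_genEig B fun ν v hv => ?_
  rw [Matrix.sum_mulVec, Matrix.one_mulVec]
  by_cases h : ν ∈ spectrum ℂ B
  · rw [← hspec] at h
    obtain ⟨i, rfl⟩ := h
    rw [Finset.sum_eq_single i, specProj_mulVec_self B hv]
    · intro j _ hj
      exact specProj_mulVec_of_ne B (fun e => hj (hinj e).symm) hv
    · simp
  · rw [genEig_eq_bot B h, Submodule.mem_bot] at hv
    simp [hv]

/-- The restriction of B - μ to the generalized eigenspace is nilpotent, and the dimension of that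
space is the algebraic multiplicity. Its characteristic polynomial is therefore a pure power of X,
and Cayley–Hamilton gives the exponent. -/
theorem sub_pow_algMult_mulVec {μ : ℂ} {v : J → ℂ} (hv : v ∈ genEig B μ) {r : ℕ}
    (hr : algMult B μ ≤ r) : ((B - μ • 1) ^ r).mulVec v = 0 := by
  set f : Module.End ℂ (J → ℂ) := Matrix.toLin' B with hf
  have hmap := Module.End.mapsTo_maxGenEigenspace_of_comm
    (Algebra.mul_sub_algebraMap_commutes f μ) μ
  have hnil := Module.End.isNilpotent_restrict_maxGenEigenspace_sub_algebraMap f μ hmap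
  have hfin : Module.finrank ℂ (f.maxGenEigenspace μ) = algMult B μ := by
    rw [LinearMap.finrank_maxGenEigenspace_eq, algMult, hf, Matrix.charpoly_toLin']
  set N := (f - algebraMap ℂ (Module.End ℂ (J → ℂ)) μ).restrict hmap
  have h0 : N ^ algMult B μ = 0 := by
    have := N.aeval_self_charpoly
    rwa [IsNilpotent.charpoly_eq_X_pow_finrank hnil, hfin, map_pow,
      Polynomial.aeval_X] at this
  have h1 : N ^ r = 0 := pow_eq_zero_of_le hr h0
  have h2 : ((f - algebraMap ℂ (Module.End ℂ (J → ℂ)) μ) ^ r) v = ((N ^ r) ⟨v, hv⟩ : J → ℂ) :=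
    congrArg Subtype.val (LinearMap.congr_fun (Module.End.pow_restrict r hmap) ⟨v, hv⟩).symm
  have h3 : (B - μ • 1 : Matrix J J ℂ).toLin' = f - algebraMap ℂ (Module.End ℂ (J → ℂ)) μ := by
    rw [map_sub, map_smul, Matrix.toLin'_one, Module.algebraMap_end_eq_smul_id]
  rw [← Matrix.toLin'_apply, Matrix.toLin'_pow, h3, h2, h1]
  rfl

/-- Binomial theorem for B = (B - μ) + μ, applied to vectors of the generalized eigenspace, where (B
- μ)^r vanishes from r = `algMult B μ` on. -/
theorem pow_mul_specProj (μ : ℂ) (n : ℕ) :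
    B ^ n * specProj B μ = powPart B μ n * specProj B μ := by
  rw [powPart]
  split_ifs with h0
  · rfl
  refine matrix_ext_genEig B fun ν v hv => ?_
  rw [← Matrix.mulVec_mulVec, ← Matrix.mulVec_mulVec]
  have hw := specProj_mulVec_mem B μ v
  set w := (specProj B μ).mulVec v
  have hB : B = (B - μ • 1) + μ • (1 : Matrix J J ℂ) := by simp
  have hc : Commute (B - μ • 1) (μ • (1 : Matrix J J ℂ)) :=
    (Commute.one_right _).smul_right μ
  have h1 : (B ^ n).mulVec w =
      ∑ r ∈ Finset.range (n + 1), ((n.choose r : ℂ) * μ ^ (n - r)) • ((B - μ • 1) ^ r).mulVec w := by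
    conv_lhs => rw [hB, hc.add_pow]
    rw [Matrix.sum_mulVec]
    refine Finset.sum_congr rfl fun r _ => ?_
    rw [← Matrix.smul_mulVec]
    congr 1
    rw [smul_pow, one_pow, ← nsmul_eq_mul', Matrix.mul_smul, mul_one, mul_smul,
      Nat.cast_smul_eq_nsmul]
  have h2 : (μ ^ n • polyPart B μ n).mulVec w =
      ∑ r ∈ Finset.range (algMult B μ),
        ((n.choose r : ℂ) * μ ^ (n - r)) • ((B - μ • 1) ^ r).mulVec w := by
    rw [polyPart, Finset.smul_sum, Matrix.sum_mulVec]
    refine Finset.sum_congr rfl fun r _ => ?_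
    rw [← Matrix.smul_mulVec, smul_smul]
    congr 2
    rcases le_or_gt r n with h | h
    · rw [pow_sub₀ _ h0 h, inv_pow]; ring
    -- For r > n the truncated exponent n - r is meaningless, but the binomial coefficient is 0.
    · simp [Nat.choose_eq_zero_of_lt h]
  rw [h1, h2]
  set F := fun r => ((n.choose r : ℂ) * μ ^ (n - r)) • ((B - μ • 1) ^ r).mulVec w
  -- Both sums are extended to a common range: beyond n the binomial coefficients vanish, beyond the
  -- multiplicity the powers of B - μ do.
  have e1 : ∑ r ∈ Finset.range (n + 1), F r = ∑ r ∈ Finset.range (n + 1 + algMult B μ), F r := by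
    refine Finset.sum_subset (by intro x; simp; omega) fun r _ hr => ?_
    have : n < r := by simpa using hr
    simp [F, Nat.choose_eq_zero_of_lt this]
  have e2 : ∑ r ∈ Finset.range (algMult B μ), F r =
      ∑ r ∈ Finset.range (n + 1 + algMult B μ), F r := by
    refine Finset.sum_subset (by intro x; simp; omega) fun r _ hr => ?_
    have : algMult B μ ≤ r := by simpa using hr
    simp [F, sub_pow_algMult_mulVec B hw this]
  rw [e1, e2]

theorem pow_mul_specProj_of_semisimple {μ : ℂ} (h : IsSemisimpleEigenvalue B μ) (n : ℕ) :
    B ^ n * specProj B μ = μ ^ n • specProj B μ := by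
  induction n with
  | zero => simp
  | succ n ih =>
    have h1 : B * specProj B μ = μ • specProj B μ := by
      refine matrix_ext_genEig B fun ν v _ => ?_
      have hw := specProj_mulVec_mem B μ v
      rw [h, Module.End.mem_eigenspace_iff, Matrix.toLin'_apply] at hw
      rw [← Matrix.mulVec_mulVec, hw, Matrix.smul_mulVec]
    rw [pow_succ, mul_assoc, h1, Matrix.mul_smul, ih, smul_smul, pow_succ, mul_comm]

/-- For μ = 0 the sequence is eventually zero by nilpotency. Otherwise its scalar coefficients are
O(n^r |μ|^n) with finitely many r. -/
theorem tendsto_pow_mul_specProj {μ : ℂ} (hμ : ‖μ‖ < 1) :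
    Tendsto (fun n : ℕ => B ^ n * specProj B μ) atTop (𝓝 0) := by
  by_cases h0 : μ = 0
  · subst h0
    refine tendsto_const_nhds.congr' ?_
    filter_upwards [eventually_ge_atTop (algMult B 0)] with n hn
    symm
    refine matrix_ext_genEig B fun ν v _ => ?_
    rw [← Matrix.mulVec_mulVec]
    simpa using sub_pow_algMult_mulVec B (specProj_mulVec_mem B 0 v) hn
  simp_rw [pow_mul_specProj]
  have h1 : Tendsto (fun n : ℕ => powPart B μ n) atTop (𝓝 0) := by
    have : (fun n : ℕ => powPart B μ n) = fun n : ℕ => ∑ r ∈ Finset.range (algMult B μ),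
        (μ ^ n * ((n.choose r : ℂ)) * (μ⁻¹) ^ r) • (B - μ • 1) ^ r := by
      funext n
      rw [powPart, if_neg h0, polyPart, Finset.smul_sum]
      exact Finset.sum_congr rfl fun r _ => by rw [smul_smul, mul_assoc]
    rw [this, show (0 : Matrix J J ℂ) = ∑ r ∈ Finset.range (algMult B μ),
        ((0 : ℂ) * (μ⁻¹) ^ r) • (B - μ • 1) ^ r by simp]
    refine tendsto_finsetSum _ fun r _ => ?_
    refine Tendsto.smul_const (Tendsto.mul_const _ ?_) _
    rw [tendsto_zero_iff_norm_tendsto_zero]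
    have h2 := tendsto_pow_const_mul_const_pow_of_abs_lt_one r
      (r := ‖μ‖) (by rwa [abs_of_nonneg (norm_nonneg _)])
    refine squeeze_zero (fun _ => norm_nonneg _) (fun n => ?_) h2
    rw [norm_mul, norm_pow, mul_comm, Complex.norm_natCast]
    gcongr
    exact_mod_cast Nat.choose_le_pow n r
  simpa using h1.mul_const (specProj B μ)

end SpectralLemmas

/-! ### Strongly continuous semigroups and uniqueness for a given generator -/

section Semigroups

variable {E : Type*} [NormedAddCommGroup E] [NormedSpace ℂ E]

/-- The generator of `G`, as a relation. -/
def IsGenPair (G : ℝ≥0 → E →L[ℂ] E) (f g : E) : Prop :=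
  Tendsto (fun h : ℝ≥0 => (((h : ℝ) : ℂ))⁻¹ • (G h f - f)) (𝓝[>] 0) (𝓝 g)

/-- The integral of `s ↦ G(s) g` over `[0,t]`. -/
def orbitIntegral (G : ℝ≥0 → E →L[ℂ] E) (g : E) (t : ℝ) : E :=
  ∫ s in (0 : ℝ)..t, G s.toNNReal g

namespace IsC0Semigroup

variable {G H : ℝ≥0 → E →L[ℂ] E}

theorem add_apply (hG : IsC0Semigroup G) (s t : ℝ≥0) (f : E) : G (s + t) f = G s (G t f) := by
  rw [hG.map_add]; rfl

theorem isGenPair_apply (hG : IsC0Semigroup G) {f g : E} (h : IsGenPair G f g) (t : ℝ≥0) :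
    IsGenPair G (G t f) (G t g) := by
  refine ((G t).continuous.tendsto g).comp h |>.congr fun r => ?_
  simp only [Function.comp, map_smul, map_sub]
  rw [← hG.add_apply, ← hG.add_apply, add_comm]

theorem continuous_orbit (hG : IsC0Semigroup G) (f : E) :
    Continuous fun s : ℝ => G s.toNNReal f :=
  (hG.continuous f).comp continuous_real_toNNReal

theorem tendsto_toNNReal_sub (s : ℝ) :
    Tendsto (fun y : ℝ => (y - s).toNNReal) (𝓝[>] s) (𝓝[>] (0 : ℝ≥0)) := by
  refine tendsto_nhdsWithin_iff.2 ⟨?_, ?_⟩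
  · have : Continuous fun y : ℝ => (y - s).toNNReal :=
      continuous_real_toNNReal.comp (continuous_id.sub continuous_const)
    simpa using (this.tendsto s).mono_left nhdsWithin_le_nhds
  · filter_upwards [self_mem_nhdsWithin] with y hy
    simpa using hy

theorem hasDerivWithinAt_orbit (hG : IsC0Semigroup G) {f g : E} (h : IsGenPair G f g) {s : ℝ}
    (hs : 0 ≤ s) :
    HasDerivWithinAt (fun s : ℝ => G s.toNNReal f) (G s.toNNReal g) (Ici s) s := by
  rw [← hasDerivWithinAt_Ioi_iff_Ici, hasDerivWithinAt_iff_tendsto_slope' (by simp)]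
  refine ((hG.isGenPair_apply h s.toNNReal).comp (tendsto_toNNReal_sub s)).congr' ?_
  filter_upwards [self_mem_nhdsWithin] with y hy
  have hy' : s < y := hy
  have e : y.toNNReal = (y - s).toNNReal + s.toNNReal := by
    rw [← Real.toNNReal_add (by linarith) hs]; congr 1; ring
  simp only [Function.comp, slope, vsub_eq_sub]
  rw [e, hG.add_apply, Real.coe_toNNReal _ (by linarith), ← Complex.ofReal_inv, Complex.coe_smul]

variable [CompleteSpace E]

theorem exists_bound (hG : IsC0Semigroup G) (a : ℝ≥0) : ∃ C : ℝ, ∀ t ≤ a, ‖G t‖ ≤ C := by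
  obtain ⟨C, hC⟩ := banach_steinhaus (g := fun t : Icc (0 : ℝ≥0) a => G t) (fun f => by
    obtain ⟨C, hC⟩ := (isCompact_Icc (a := (0 : ℝ≥0)) (b := a)).exists_bound_of_continuousOn
      (hG.continuous f).continuousOn
    exact ⟨C, fun t => hC t t.2⟩)
  exact ⟨C, fun t ht => hC ⟨t, zero_le, ht⟩⟩

/-- Strong continuity and the local uniform bound from Banach–Steinhaus give joint continuity. It is
needed for s ↦ G(t - s)H(s)f, where operator and vector both vary. -/
theorem continuous_uncurry (hG : IsC0Semigroup G) : Continuous fun q : ℝ≥0 × E => G q.1 q.2 := by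
  rw [continuous_iff_continuousAt]
  rintro ⟨t, f⟩
  obtain ⟨C, hC⟩ := hG.exists_bound (t + 1)
  have h1 : Tendsto (fun q : ℝ≥0 × E => G q.1 (q.2 - f)) (𝓝 (t, f)) (𝓝 0) := by
    have h0 : Tendsto (fun q : ℝ≥0 × E => C * ‖q.2 - f‖) (𝓝 (t, f)) (𝓝 0) := by
      have : Continuous fun q : ℝ≥0 × E => C * ‖q.2 - f‖ := by fun_prop
      simpa using this.tendsto (t, f)
    refine squeeze_zero_norm' ?_ h0
    have : ∀ᶠ q : ℝ≥0 × E in 𝓝 (t, f), q.1 < t + 1 :=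
      (continuous_fst.tendsto (t, f)).eventually_lt_const (by simp)
    filter_upwards [this] with q hq
    exact (G q.1).le_of_opNorm_le (hC _ hq.le) _
  have h2 : Tendsto (fun q : ℝ≥0 × E => G q.1 f) (𝓝 (t, f)) (𝓝 (G t f)) :=
    ((hG.continuous f).comp continuous_fst).tendsto (t, f)
  simpa [ContinuousAt] using h1.add h2

/-- The generator supplies only right derivatives; a continuous function with vanishing right
derivative is constant, and this is enough. -/
theorem apply_sub_eq_integral (hG : IsC0Semigroup G) {f g : E} (h : IsGenPair G f g) {t : ℝ}
    (ht : 0 ≤ t) : G t.toNNReal f - f = orbitIntegral G g t := by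
  have hc := hG.continuous_orbit g
  have := constant_of_has_deriv_right_zero (a := 0) (b := t)
    (f := fun s : ℝ => G s.toNNReal f - ∫ r in (0 : ℝ)..s, G r.toNNReal g)
    ((hG.continuous_orbit f).sub
      (intervalIntegral.continuous_primitive (fun a b => hc.intervalIntegrable a b) 0)).continuousOn
    (fun s hs => by
      have h1 := hG.hasDerivWithinAt_orbit h hs.1
      have h2 := (hc.integral_hasStrictDerivAt 0 s).hasDerivAt.hasDerivWithinAt (s := Ici s)
      have h3 := h1.sub h2
      rw [sub_self] at h3
      exact h3) t ⟨ht, le_rfl⟩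
  simp only [Real.toNNReal_zero, intervalIntegral.integral_same, sub_zero, hG.map_zero,
    ContinuousLinearMap.id_apply] at this
  rw [sub_eq_iff_eq_add'] at this
  rw [this, add_sub_cancel_right, orbitIntegral]

/-- Fundamental theorem of calculus at 0. A short time interval suffices, so for `transport` only
times below 1, with at most one boundary passage, have to be examined. -/
theorem isGenPair_of_integral (hG : IsC0Semigroup G) {f g : E} {ε : ℝ} (hε : 0 < ε)
    (h : ∀ t : ℝ, 0 < t → t < ε → G t.toNNReal f - f = orbitIntegral G g t) :
    IsGenPair G f g := by
  have hc := hG.continuous_orbit g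
  have h2 := (hc.integral_hasStrictDerivAt 0 0).hasDerivAt.hasDerivWithinAt (s := Ioi 0)
  rw [hasDerivWithinAt_iff_tendsto_slope' (by simp)] at h2
  have h3 : Tendsto (fun h : ℝ≥0 => (h : ℝ)) (𝓝[>] 0) (𝓝[>] 0) := by
    refine tendsto_nhdsWithin_iff.2 ⟨?_, ?_⟩
    · exact (NNReal.continuous_coe.tendsto 0).mono_left nhdsWithin_le_nhds
    · filter_upwards [self_mem_nhdsWithin] with y hy
      simpa using hy
  have h4 := h2.comp h3
  simp only [Real.toNNReal_zero, hG.map_zero, ContinuousLinearMap.id_apply] at h4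
  refine h4.congr' ?_
  have h5 : ∀ᶠ r : ℝ in 𝓝[>] 0, r < ε := nhdsWithin_le_nhds (eventually_lt_nhds hε)
  filter_upwards [h3.eventually h5, self_mem_nhdsWithin] with r hr hr0
  have hr0' : (0 : ℝ) < r := hr0
  simp only [Function.comp, slope, vsub_eq_sub, intervalIntegral.integral_same, sub_zero]
  rw [← orbitIntegral, ← h r hr0' hr, Real.toNNReal_coe, ← Complex.ofReal_inv, Complex.coe_smul]

/-- Applying G(t) to the integral over [0,h] shifts the interval to [t,t+h]; the difference of the
two integrals is also that of the integrals over [h,t+h] and [0,t]. -/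
theorem isGenPair_integral (hG : IsC0Semigroup G) (f : E) {h : ℝ} (hh : 0 < h) :
    IsGenPair G (∫ s in (0 : ℝ)..h, G s.toNNReal f) (G h.toNNReal f - f) := by
  have hc := hG.continuous_orbit f
  have hi : ∀ a b : ℝ, IntervalIntegrable (fun s : ℝ => G s.toNNReal f) volume a b :=
    fun a b => hc.intervalIntegrable a b
  refine hG.isGenPair_of_integral one_pos fun t ht _ => ?_
  have hcomm : ∀ r : ℝ, G r.toNNReal (∫ s in (0 : ℝ)..h, G s.toNNReal f) =
      ∫ s in (0 : ℝ)..h, G r.toNNReal (G s.toNNReal f) := fun r =>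
    ((G r.toNNReal).intervalIntegral_comp_comm (hi 0 h)).symm
  have h1 : ∀ r : ℝ, 0 ≤ r → (∫ s in (0 : ℝ)..h, G r.toNNReal (G s.toNNReal f)) =
      ∫ s in r..(h + r), G s.toNNReal f := by
    intro r hr
    have := intervalIntegral.integral_comp_add_right (a := 0) (b := h)
      (fun s => G s.toNNReal f) r
    rw [zero_add] at this
    rw [← this]
    refine intervalIntegral.integral_congr fun s hs => ?_
    rw [uIcc_of_le hh.le] at hs
    rw [← hG.add_apply, ← Real.toNNReal_add hr hs.1, add_comm]
  rw [orbitIntegral, hcomm, h1 t ht.le]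
  have h2 : (∫ s in (0 : ℝ)..t, G s.toNNReal (G h.toNNReal f - f)) =
      (∫ s in h..(t + h), G s.toNNReal f) - ∫ s in (0 : ℝ)..t, G s.toNNReal f := by
    simp only [map_sub]
    rw [intervalIntegral.integral_sub ((hG.continuous_orbit _).intervalIntegrable _ _) (hi _ _)]
    congr 1
    have := intervalIntegral.integral_comp_add_right (a := 0) (b := t)
      (fun s => G s.toNNReal f) h
    rw [zero_add] at this
    rw [← this]
    refine intervalIntegral.integral_congr fun s hs => ?_
    rw [uIcc_of_le ht.le] at hs
    rw [← hG.add_apply, ← Real.toNNReal_add hs.1 hh.le]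
  rw [h2, add_comm h t]
  have e1 := intervalIntegral.integral_add_adjacent_intervals (hi 0 t) (hi t (t + h))
  have e2 := intervalIntegral.integral_add_adjacent_intervals (hi 0 h) (hi h (t + h))
  rw [sub_eq_sub_iff_add_eq_add, add_comm, e1, ← e2, add_comm]

/-- The averages (1/h)∫₀ʰ G(s)f lie in the domain and converge to f. -/
theorem dense_domain (hG : IsC0Semigroup G) : Dense {f : E | ∃ g, IsGenPair G f g} := by
  intro f
  have hc := hG.continuous_orbit f
  have h2 := (hc.integral_hasStrictDerivAt 0 0).hasDerivAt.hasDerivWithinAt (s := Ioi 0)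
  rw [hasDerivWithinAt_iff_tendsto_slope' (by simp)] at h2
  simp only [Real.toNNReal_zero, hG.map_zero, ContinuousLinearMap.id_apply] at h2
  refine mem_closure_of_tendsto h2 ?_
  filter_upwards [self_mem_nhdsWithin] with h hh
  simp only [slope, vsub_eq_sub, intervalIntegral.integral_same, sub_zero]
  refine ⟨((h⁻¹ : ℝ) : ℂ) • (G h.toNNReal f - f), ?_⟩
  have := (hG.isGenPair_integral f hh).const_smul ((h⁻¹ : ℝ) : ℂ)
  refine this.congr fun r => ?_
  rw [← Complex.coe_smul, map_smul, ← smul_sub, smul_comm]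

/-- A strongly continuous semigroup is determined by its generator. -/
theorem eq_of_isGenPair_imp (hG : IsC0Semigroup G) (hH : IsC0Semigroup H)
    (h : ∀ f g, IsGenPair H f g → IsGenPair G f g) : G = H := by
  funext t
  refine ContinuousLinearMap.ext_on (hH.dense_domain.mono Submodule.subset_span) ?_
  rintro f ⟨g, hfg⟩
  obtain ⟨C, hC⟩ := hG.exists_bound t
  -- The path s ↦ G(t - s)H(s)f joins G(t)f to H(t)f; its right derivative vanishes because both
  -- generators take the same value at H(s)f.
  have key := constant_of_has_deriv_right_zero (a := 0) (b := (t : ℝ))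
    (f := fun s : ℝ => G ((t : ℝ) - s).toNNReal (H s.toNNReal f))
    (hG.continuous_uncurry.comp ((continuous_real_toNNReal.comp
      (continuous_const.sub continuous_id)).prodMk (hH.continuous_orbit f))).continuousOn
    (fun s hs => ?_) t ⟨t.2, le_rfl⟩
  · simpa [hG.map_zero, hH.map_zero] using key.symm
  rw [← hasDerivWithinAt_Ioi_iff_Ici, hasDerivWithinAt_iff_tendsto_slope' (by simp)]
  set u := H s.toNNReal f with hu
  have hHu := hH.isGenPair_apply hfg s.toNNReal
  have hGu := h _ _ hHu
  have h0 : Tendsto (fun y : ℝ => C * ‖((((y - s).toNNReal : ℝ) : ℂ))⁻¹ • (H (y - s).toNNReal u - u)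
      - ((((y - s).toNNReal : ℝ) : ℂ))⁻¹ • (G (y - s).toNNReal u - u)‖) (𝓝[>] s) (𝓝 0) := by
    have := (((hHu.sub hGu).comp (tendsto_toNNReal_sub s)).norm).const_mul C
    simpa using this
  refine squeeze_zero_norm' ?_ h0
  have h5 : ∀ᶠ y : ℝ in 𝓝[>] s, y < t := nhdsWithin_le_nhds (eventually_lt_nhds hs.2)
  filter_upwards [self_mem_nhdsWithin, h5] with y hy hyt
  have hy' : s < y := hy
  have hs0 := hs.1
  have e1 : H y.toNNReal f = H (y - s).toNNReal u := by
    rw [hu, ← hH.add_apply, ← Real.toNNReal_add (by linarith) hs.1]; congr 2; congr 1; ring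
  have e2 : G ((t : ℝ) - s).toNNReal u = G ((t : ℝ) - y).toNNReal (G (y - s).toNNReal u) := by
    rw [← hG.add_apply, ← Real.toNNReal_add (by linarith) (by linarith)]; congr 2; congr 1; ring
  -- The slope is G(t - y) applied to the difference of two quotients with the same limit, and G is
  -- bounded by C on [0,t].
  have e3 : slope (fun s : ℝ => G ((t : ℝ) - s).toNNReal (H s.toNNReal f)) s y =
      G ((t : ℝ) - y).toNNReal (((((y - s).toNNReal : ℝ) : ℂ))⁻¹ • (H (y - s).toNNReal u - u)
      - ((((y - s).toNNReal : ℝ) : ℂ))⁻¹ • (G (y - s).toNNReal u - u)) := by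
    simp only [slope, vsub_eq_sub]
    rw [← hu, e1, e2, ← map_sub, ← smul_sub, map_smul, Real.coe_toNNReal _ (by linarith),
      ← Complex.ofReal_inv, Complex.coe_smul]
    congr 2
    abel
  rw [e3]
  refine (G _).le_of_opNorm_le (hC _ ?_) _
  rw [Real.toNNReal_le_iff_le_coe]
  linarith

end IsC0Semigroup

end Semigroups

/-! ### Translations on (0,1) with extension by zero -/

section Shift

instance isProbabilityMeasure_unitVol : IsProbabilityMeasure unitVol :=
  ⟨by simp [unitVol]⟩

theorem ae_unitVol_iff {P : ℝ → Prop} :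
    (∀ᵐ x ∂unitVol, P x) ↔ ∀ᵐ x : ℝ, x ∈ Ioo (0 : ℝ) 1 → P x :=
  ae_restrict_iff' measurableSet_Ioo

theorem ae_unitVol_mem : ∀ᵐ x ∂unitVol, x ∈ Ioo (0 : ℝ) 1 :=
  ae_unitVol_iff.2 (Eventually.of_forall fun _ h => h)

theorem ae_unitVol_add {P : ℝ → Prop} (h : ∀ᵐ x ∂unitVol, P x) (a : ℝ) :
    ∀ᵐ x : ℝ, x + a ∈ Ioo (0 : ℝ) 1 → P (x + a) :=
  (measurePreserving_add_right volume a).quasiMeasurePreserving.ae (ae_unitVol_iff.1 h)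

theorem ae_unitVol_reflect {P : ℝ → Prop} (h : ∀ᵐ x ∂unitVol, P x) :
    ∀ᵐ x ∂unitVol, P (1 - x) :=
  measurePreserving_reflect.quasiMeasurePreserving.ae h

variable {p : ℝ≥0∞}

/-- The extension by zero of a function on `(0,1)`. -/
def zeroExt (g : ℝ → ℂ) : ℝ → ℂ := (Ioo (0 : ℝ) 1).indicator g

theorem zeroExt_of_mem {g : ℝ → ℂ} {x : ℝ} (hx : x ∈ Ioo (0 : ℝ) 1) : zeroExt g x = g x :=
  indicator_of_mem hx g

theorem zeroExt_of_notMem {g : ℝ → ℂ} {x : ℝ} (hx : x ∉ Ioo (0 : ℝ) 1) : zeroExt g x = 0 :=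
  indicator_of_notMem hx g

theorem memLp_zeroExt (g : Lp ℂ p unitVol) : MemLp (zeroExt g) p volume :=
  (memLp_indicator_iff_restrict measurableSet_Ioo).2 (Lp.memLp g)

theorem stronglyMeasurable_zeroExt (g : Lp ℂ p unitVol) : StronglyMeasurable (zeroExt g) :=
  (Lp.stronglyMeasurable g).indicator measurableSet_Ioo

theorem zeroExt_ae_congr {f g : ℝ → ℂ} (h : f =ᵐ[unitVol] g) :
    zeroExt f =ᵐ[volume] zeroExt g := by
  filter_upwards [ae_unitVol_iff.1 h] with x hx
  by_cases hm : x ∈ Ioo (0 : ℝ) 1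
  · rw [zeroExt_of_mem hm, zeroExt_of_mem hm, hx hm]
  · rw [zeroExt_of_notMem hm, zeroExt_of_notMem hm]

theorem exists_branch_ae (t : ℝ≥0) :
    ∀ᵐ x ∂unitVol, ∃ n : ℕ, x + ((n : ℝ) - t) ∈ Ioo (0 : ℝ) 1 := by
  have hc : (range fun n : ℕ => (t : ℝ) - n).Countable := countable_range _
  filter_upwards [ae_unitVol_mem, ae_restrict_of_ae (hc.ae_notMem volume)] with x hx hx'
  -- The branch index is the least natural number n ≥ t - x. Equality would put the foot point at
  -- the endpoint 0, which is excluded outside the countable set of the t - n.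
  refine ⟨⌈(t : ℝ) - x⌉₊, ?_, ?_⟩
  · have h1 := Nat.le_ceil ((t : ℝ) - x)
    have h2 : (t : ℝ) - x ≠ ⌈(t : ℝ) - x⌉₊ := fun h => hx' ⟨⌈(t : ℝ) - x⌉₊, by simp only; linarith⟩
    have := lt_of_le_of_ne h1 h2
    linarith
  · rcases le_or_gt 0 ((t : ℝ) - x) with h | h
    · linarith [Nat.ceil_lt_add_one h]
    · rw [Nat.ceil_eq_zero.2 h.le]
      have := NNReal.coe_nonneg t
      push_cast
      linarith [hx.2]

theorem coeFn_sum_smul {ι : Type*} (s : Finset ι) (c : ι → ℂ) (g : ι → Lp ℂ p unitVol) :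
    (∑ j ∈ s, c j • g j : Lp ℂ p unitVol) =ᵐ[unitVol] fun x => ∑ j ∈ s, c j * g j x := by
  classical
  induction s using Finset.induction_on with
  | empty =>
    simp only [Finset.sum_empty]
    exact Lp.coeFn_zero ℂ p unitVol
  | insert a s ha ih =>
    rw [Finset.sum_insert ha]
    filter_upwards [Lp.coeFn_add (c a • g a) (∑ j ∈ s, c j • g j), Lp.coeFn_smul (c a) (g a), ih]
      with x h1 h2 h3
    rw [h1, Pi.add_apply, h2, h3, Finset.sum_insert ha]
    rfl

variable [Fact (1 ≤ p)]

theorem integrable_Lp (g : Lp ℂ p unitVol) : Integrable g unitVol :=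
  (Lp.memLp g).integrable Fact.out

theorem integrable_zeroExt (g : Lp ℂ p unitVol) : Integrable (zeroExt g) volume :=
  (integrable_indicator_iff measurableSet_Ioo).2 (integrable_Lp g)

variable (p) in
/-- The extension by zero as an isometry from `L^p(0,1)` to `L^p(ℝ)`. -/
def zeroExtLp : Lp ℂ p unitVol →ₗᵢ[ℂ] Lp ℂ p (volume : Measure ℝ) where
  toFun g := (memLp_zeroExt g).toLp _
  map_add' f g := by
    rw [← MemLp.toLp_add, MemLp.toLp_eq_toLp_iff]
    refine (zeroExt_ae_congr (Lp.coeFn_add f g)).trans ?_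
    exact EventuallyEq.of_eq (indicator_add' _ _ _)
  map_smul' c g := by
    rw [RingHom.id_apply, ← MemLp.toLp_const_smul, MemLp.toLp_eq_toLp_iff]
    refine (zeroExt_ae_congr (Lp.coeFn_smul c g)).trans ?_
    exact EventuallyEq.of_eq (indicator_const_smul _ c _)
  norm_map' g := by
    change ‖(memLp_zeroExt g).toLp _‖ = ‖g‖
    rw [Lp.norm_toLp, zeroExt, eLpNorm_indicator_eq_eLpNorm_restrict measurableSet_Ioo, Lp.norm_def]

theorem coeFn_zeroExtLp (g : Lp ℂ p unitVol) : zeroExtLp p g =ᵐ[volume] zeroExt g :=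
  (memLp_zeroExt g).coeFn_toLp

variable (p) in
/-- The operator `g ↦ g(· + a)` on `L^p(0,1)`, where `g` is extended by zero. -/
def shift (a : ℝ) : Lp ℂ p unitVol →L[ℂ] Lp ℂ p unitVol :=
  (LpToLpRestrictCLM ℝ ℂ ℂ volume p (Ioo (0 : ℝ) 1)).comp
    ((Lp.compMeasurePreservingₗᵢ ℂ (fun x : ℝ => x + a)
      (measurePreserving_add_right volume a)).toContinuousLinearMap.comp
      (zeroExtLp p).toContinuousLinearMap)

theorem coeFn_shift (a : ℝ) (g : Lp ℂ p unitVol) :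
    shift p a g =ᵐ[unitVol] fun x => zeroExt g (x + a) := by
  have h1 := LpToLpRestrictCLM_coeFn (p := p) (μ := (volume : Measure ℝ)) ℂ (Ioo (0 : ℝ) 1)
    (Lp.compMeasurePreserving (fun x : ℝ => x + a) (measurePreserving_add_right volume a)
      (zeroExtLp p g))
  refine h1.trans (ae_restrict_of_ae ?_)
  refine (Lp.coeFn_compMeasurePreserving _ _).trans ?_
  exact (measurePreserving_add_right volume a).quasiMeasurePreserving.ae (coeFn_zeroExtLp g)

theorem shift_eq_zero {a : ℝ} (ha : 1 ≤ |a|) : shift p a = 0 := by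
  ext1 g
  refine Lp.ext ((coeFn_shift a g).trans ?_)
  filter_upwards [ae_unitVol_mem, Lp.coeFn_zero ℂ p unitVol] with x hx h0
  rw [zero_apply, h0, Pi.zero_apply]
  refine zeroExt_of_notMem fun h => ?_
  rcases le_abs.1 ha with h' | h' <;> linarith [h.1, h.2, hx.1, hx.2]

theorem shift_zero : shift p 0 = ContinuousLinearMap.id ℂ _ := by
  ext1 g
  refine Lp.ext ((coeFn_shift 0 g).trans ?_)
  filter_upwards [ae_unitVol_mem] with x hx
  rw [add_zero, zeroExt_of_mem hx, ContinuousLinearMap.id_apply]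

theorem continuous_shift (hp : p ≠ ⊤) (g : Lp ℂ p unitVol) : Continuous fun a => shift p a g := by
  refine (LpToLpRestrictCLM ℝ ℂ ℂ volume p (Ioo (0 : ℝ) 1)).continuous.comp ?_
  -- Currying the addition gives a continuous family of translations, as required for continuity of
  -- composition in L^p with p finite.
  let F : C(ℝ × ℝ, ℝ) := ⟨fun q => q.2 + q.1, by fun_prop⟩
  exact Continuous.compMeasurePreservingLp (f := fun _ : ℝ => zeroExtLp p g)
    (g := fun a => F.curry a) continuous_const F.curry.continuous
    (fun a => measurePreserving_add_right volume a) hp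

variable (p) in
/-- Integration over a measurable set as a functional on `L^p(0,1)`. -/
def setIntegralCLM (s : Set ℝ) : Lp ℂ p unitVol →L[ℂ] ℂ :=
  LinearMap.mkContinuous
    { toFun := fun f => ∫ x in s, f x ∂unitVol
      map_add' := fun f g => by
        rw [← integral_add (integrable_Lp f).integrableOn (integrable_Lp g).integrableOn]
        exact integral_congr_ae (ae_restrict_of_ae (Lp.coeFn_add f g))
      map_smul' := fun c f => by
        rw [RingHom.id_apply, ← integral_smul]
        exact integral_congr_ae (ae_restrict_of_ae (Lp.coeFn_smul c f)) } 1 fun f => by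
    rw [one_mul]
    change ‖∫ x in s, f x ∂unitVol‖ ≤ _
    calc ‖∫ x in s, f x ∂unitVol‖ ≤ ∫ x in s, ‖f x‖ ∂unitVol := norm_integral_le_integral_norm _
      _ ≤ ∫ x, ‖f x‖ ∂unitVol := setIntegral_le_integral (integrable_Lp f).norm
          (Eventually.of_forall fun x => norm_nonneg _)
      _ = (eLpNorm f 1 unitVol).toReal := by
          rw [integral_norm_eq_lintegral_enorm (Lp.aestronglyMeasurable f),
            eLpNorm_one_eq_lintegral_enorm]
      _ ≤ (eLpNorm f p unitVol).toReal := ENNReal.toReal_mono (Lp.eLpNorm_ne_top f)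
          (eLpNorm_le_eLpNorm_of_exponent_le Fact.out (Lp.aestronglyMeasurable f))
      _ = ‖f‖ := (Lp.norm_def f).symm

/-- By translation invariance the L¹ norms of the slices are bounded by that of the extended
function, uniformly in s. This justifies Fubini in `coeFn_integral_shift`. -/
theorem integrable_prod_zeroExt (g : Lp ℂ p unitVol) (a b r : ℝ) :
    Integrable (Function.uncurry fun s x : ℝ => zeroExt g (x + (r - s)))
      ((volume.restrict (uIoc a b)).prod unitVol) := by
  have hm : AEStronglyMeasurable (Function.uncurry fun s x : ℝ => zeroExt g (x + (r - s)))
      ((volume.restrict (uIoc a b)).prod unitVol) :=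
    ((stronglyMeasurable_zeroExt g).comp_measurable (by fun_prop)).aestronglyMeasurable
  have hi : ∀ c : ℝ, Integrable (fun x : ℝ => zeroExt g (x + c)) volume := fun c =>
    (integrable_zeroExt g).comp_add_right c
  rw [integrable_prod_iff hm]
  have : IsFiniteMeasure (volume.restrict (uIoc a b)) := ⟨by simp [uIoc]⟩
  refine ⟨Eventually.of_forall fun s => (hi (r - s)).restrict, ?_⟩
  refine Integrable.of_bound hm.norm.integral_prod_right' (∫ x, ‖zeroExt g x‖)
    (Eventually.of_forall fun s => ?_)
  rw [Real.norm_of_nonneg (integral_nonneg fun _ => norm_nonneg _)]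
  refine (setIntegral_le_integral (hi (r - s)).norm
    (Eventually.of_forall fun x => norm_nonneg _)).trans_eq ?_
  exact integral_add_right_eq_self (fun x => ‖zeroExt g x‖) (r - s)

/-- An L^p-valued integral may be evaluated pointwise: both sides have the same integral over every
measurable set, because `setIntegralCLM` commutes with the integral in s and Fubini exchanges the
order. -/
theorem coeFn_integral_shift (hp : p ≠ ⊤) (g : Lp ℂ p unitVol) (a b r : ℝ) :
    (∫ s in a..b, shift p (r - s) g : Lp ℂ p unitVol) =ᵐ[unitVol]
      fun x => ∫ s in a..b, zeroExt g (x + (r - s)) := by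
  have hint := integrable_prod_zeroExt g a b r
  refine Integrable.ae_eq_of_forall_setIntegral_eq _ _ (integrable_Lp _) ?_ fun E hE _ => ?_
  · have := hint.integral_prod_right
    simp only [intervalIntegral.intervalIntegral_eq_integral_uIoc]
    exact this.smul _
  have hc : Continuous fun s => shift p (r - s) g :=
    (continuous_shift hp g).comp (continuous_const.sub continuous_id)
  have h1 : ∫ x in E, (∫ s in a..b, shift p (r - s) g : Lp ℂ p unitVol) x ∂unitVol =
      ∫ s in a..b, ∫ x in E, shift p (r - s) g x ∂unitVol :=
    ((setIntegralCLM p E).intervalIntegral_comp_comm (hc.intervalIntegrable a b)).symm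
  have h2 : ∀ s, ∫ x in E, shift p (r - s) g x ∂unitVol =
      ∫ x in E, zeroExt g (x + (r - s)) ∂unitVol := fun s =>
    integral_congr_ae (ae_restrict_of_ae (coeFn_shift (r - s) g))
  rw [h1]
  simp_rw [h2]
  refine intervalIntegral_integral_swap (hint.mono_measure ?_)
  exact Measure.prod_mono le_rfl Measure.restrict_le_self

end Shift

/-! ### Tensor products of a matrix with an operator on L^p(0,1) -/

section Tensor

variable {p : ℝ≥0∞} [Fact (1 ≤ p)] {J : Type*} [Fintype J]

variable (p) in
/-- The operator on `(L^p(0,1))^J` with entries `M i j • S`. -/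
def tens (M : Matrix J J ℂ) (S : Lp ℂ p unitVol →L[ℂ] Lp ℂ p unitVol) :
    XSpace p J →L[ℂ] XSpace p J :=
  ((PiLp.continuousLinearEquiv p ℂ (fun _ : J => Lp ℂ p unitVol)).symm :
      (J → Lp ℂ p unitVol) →L[ℂ] XSpace p J).comp
    (ContinuousLinearMap.pi fun i => ∑ j, M i j • S.comp (PiLp.proj p (fun _ : J => Lp ℂ p unitVol) j))

theorem tens_apply (M : Matrix J J ℂ) (S : Lp ℂ p unitVol →L[ℂ] Lp ℂ p unitVol)
    (f : XSpace p J) (i : J) : tens p M S f i = ∑ j, M i j • S (f j) := by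
  change (∑ j, M i j • S.comp (PiLp.proj p (fun _ : J => Lp ℂ p unitVol) j)) f = _
  simp

theorem tens_mul (M N : Matrix J J ℂ) (S R : Lp ℂ p unitVol →L[ℂ] Lp ℂ p unitVol) :
    (tens p M S).comp (tens p N R) = tens p (M * N) (S.comp R) := by
  ext1 f
  refine PiLp.ext fun i => ?_
  simp only [ContinuousLinearMap.comp_apply, tens_apply, map_sum, map_smul, Finset.smul_sum,
    Matrix.mul_apply, Finset.sum_smul, smul_smul]
  exact Finset.sum_comm

theorem tens_one [DecidableEq J] :
    tens p (1 : Matrix J J ℂ) (ContinuousLinearMap.id ℂ _) = ContinuousLinearMap.id ℂ _ := by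
  ext1 f
  refine PiLp.ext fun i => ?_
  simp [tens_apply, Matrix.one_apply]

theorem tens_add_left (M N : Matrix J J ℂ) (S : Lp ℂ p unitVol →L[ℂ] Lp ℂ p unitVol) :
    tens p (M + N) S = tens p M S + tens p N S := by
  ext1 f
  refine PiLp.ext fun i => ?_
  simp [tens_apply, add_smul, Finset.sum_add_distrib]

theorem tens_zero_left (S : Lp ℂ p unitVol →L[ℂ] Lp ℂ p unitVol) :
    tens p (0 : Matrix J J ℂ) S = 0 := by
  ext1 f
  refine PiLp.ext fun i => ?_
  simp [tens_apply]

theorem tens_zero_right (M : Matrix J J ℂ) : tens p M 0 = 0 := by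
  ext1 f
  refine PiLp.ext fun i => ?_
  simp [tens_apply]

theorem continuous_tens_apply {X : Type*} [TopologicalSpace X] (M : Matrix J J ℂ)
    {S : X → Lp ℂ p unitVol →L[ℂ] Lp ℂ p unitVol} (hS : ∀ g, Continuous fun x => S x g)
    (f : XSpace p J) : Continuous fun x => tens p M (S x) f := by
  refine (PiLp.continuousLinearEquiv p ℂ (fun _ : J => Lp ℂ p unitVol)).symm.continuous.comp
    (continuous_pi fun i => ?_)
  have : Continuous fun x => ∑ j, M i j • S x (f j) :=
    continuous_finsetSum _ fun j _ => (hS (f j)).const_smul (M i j)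
  refine this.congr fun x => ?_
  simp

/-- K is the norm of the identification of the sup-norm product with the ℓ^p product; only its
independence of M and S matters. -/
theorem exists_norm_tens_le : ∃ K : ℝ, 0 ≤ K ∧ ∀ (M : Matrix J J ℂ)
    (S : Lp ℂ p unitVol →L[ℂ] Lp ℂ p unitVol), ‖tens p M S‖ ≤ K * (∑ i, ∑ j, ‖M i j‖) * ‖S‖ := by
  refine ⟨_, norm_nonneg (((PiLp.continuousLinearEquiv p ℂ (fun _ : J => Lp ℂ p unitVol)).symm :
      (J → Lp ℂ p unitVol) →L[ℂ] XSpace p J)), fun M S => ?_⟩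
  rw [mul_assoc]
  refine (ContinuousLinearMap.opNorm_comp_le _ _).trans ?_
  refine mul_le_mul_of_nonneg_left ?_ (norm_nonneg _)
  have h0 : 0 ≤ (∑ i, ∑ j, ‖M i j‖) * ‖S‖ := by positivity
  refine ContinuousLinearMap.opNorm_le_bound _ h0 fun f => ?_
  rw [pi_norm_le_iff_of_nonneg (by positivity)]
  intro i
  have h1 : ∀ j, ‖M i j • S (f j)‖ ≤ ‖M i j‖ * ‖S‖ * ‖f‖ := fun j => by
    rw [norm_smul, mul_assoc]
    gcongr
    exact (S.le_opNorm _).trans (by gcongr; exact PiLp.norm_apply_le f j)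
  calc ‖(∑ j, M i j • S.comp (PiLp.proj p (fun _ : J => Lp ℂ p unitVol) j)) f‖
      = ‖∑ j, M i j • S (f j)‖ := by simp
    _ ≤ ∑ j, ‖M i j‖ * ‖S‖ * ‖f‖ := norm_sum_le_of_le _ fun j _ => h1 j
    _ = (∑ j, ‖M i j‖) * ‖S‖ * ‖f‖ := by rw [Finset.sum_mul, Finset.sum_mul]
    _ ≤ (∑ i, ∑ j, ‖M i j‖) * ‖S‖ * ‖f‖ := by
      refine mul_le_mul_of_nonneg_right (mul_le_mul_of_nonneg_right ?_ (norm_nonneg _))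
        (norm_nonneg _)
      exact Finset.single_le_sum (f := fun i => ∑ j, ‖M i j‖) (fun i _ => by positivity)
        (Finset.mem_univ i)

theorem coeFn_tens (M : Matrix J J ℂ) (S : Lp ℂ p unitVol →L[ℂ] Lp ℂ p unitVol)
    (f : XSpace p J) (i : J) : tens p M S f i =ᵐ[unitVol] fun x => ∑ j, M i j * S (f j) x := by
  rw [tens_apply]
  exact coeFn_sum_smul _ _ _

end Tensor

/-! ### The explicit semigroup along characteristics -/

section Transport

variable (p : ℝ≥0∞) [Fact (1 ≤ p)] {J : Type*} [Fintype J] [DecidableEq J] (B : Matrix J J ℂ)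

/-- The transport semigroup when all components flow from `0` to `1`. -/
def transport (t : ℝ≥0) : XSpace p J →L[ℂ] XSpace p J :=
  ∑ n ∈ Finset.range (⌈t⌉₊ + 1), tens p (B ^ n) (shift p ((n : ℝ) - t))

/-- Translations by at least 1 vanish, so the cut-off may be any large N. A cut-off that works for
all times near t is what continuity in time requires. -/
theorem transport_eq_sum_range {t : ℝ≥0} {N : ℕ} (hN : (t : ℝ) + 1 ≤ N) :
    transport p B t = ∑ n ∈ Finset.range N, tens p (B ^ n) (shift p ((n : ℝ) - t)) := by
  have hz : ∀ n : ℕ, (t : ℝ) + 1 ≤ n → tens p (B ^ n) (shift p ((n : ℝ) - t)) = 0 := by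
    intro n hn
    rw [shift_eq_zero (by rw [le_abs]; left; linarith), tens_zero_right]
  have hNt : ⌈t⌉₊ + 1 ≤ N := by
    have : ⌈t⌉₊ ≤ N - 1 := by
      rw [Nat.ceil_le, ← NNReal.coe_le_coe, NNReal.coe_natCast]
      have : (N : ℝ) ≤ ((N - 1 : ℕ) : ℝ) + 1 := by norm_cast; omega
      linarith
    have : 0 < N := by
      have : (0 : ℝ) < N := by linarith [t.2, NNReal.coe_nonneg t]
      exact_mod_cast this
    omega
  refine Finset.sum_subset (by intro x; simp only [Finset.mem_range]; omega) fun n _ hn => ?_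
  refine hz n ?_
  have h1 : ⌈t⌉₊ + 1 ≤ n := by simpa using hn
  have h2 : (t : ℝ) ≤ (⌈t⌉₊ : ℝ) := by
    have := Nat.le_ceil t
    exact_mod_cast this
  have h3 : ((⌈t⌉₊ + 1 : ℕ) : ℝ) ≤ n := by exact_mod_cast h1
  push_cast at h3
  linarith

/-- The foot points x + n - t for different n differ by at least 1, so at most one of them lies in
(0,1) and a single summand survives. -/
theorem transport_apply_ae (t : ℝ≥0) (f : XSpace p J) :
    ∀ᵐ x ∂unitVol, ∀ n : ℕ, x + ((n : ℝ) - t) ∈ Ioo (0 : ℝ) 1 → ∀ i,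
      transport p B t f i x = ∑ j, (B ^ n) i j * f j (x + ((n : ℝ) - t)) := by
  obtain ⟨N, hN⟩ := exists_nat_ge ((t : ℝ) + 1)
  have h1 : ∀ᵐ x ∂unitVol, ∀ i, transport p B t f i x = ∑ n ∈ Finset.range N,
      tens p (B ^ n) (shift p ((n : ℝ) - t)) f i x := by
    refine ae_all_iff.2 fun i => ?_
    have e : transport p B t f i = ∑ n ∈ Finset.range N,
        (1 : ℂ) • tens p (B ^ n) (shift p ((n : ℝ) - t)) f i := by
      rw [transport_eq_sum_range p B hN, sum_apply, WithLp.ofLp_sum,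
        Finset.sum_apply]
      simp
    rw [e]
    filter_upwards [coeFn_sum_smul (Finset.range N) (fun _ => 1)
      (fun n => tens p (B ^ n) (shift p ((n : ℝ) - t)) f i)] with x hx
    simpa using hx
  have h2 : ∀ᵐ x ∂unitVol, ∀ n : ℕ, ∀ i, tens p (B ^ n) (shift p ((n : ℝ) - t)) f i x =
      ∑ j, (B ^ n) i j * zeroExt (f j) (x + ((n : ℝ) - t)) := by
    refine ae_all_iff.2 fun n => ae_all_iff.2 fun i => ?_
    have h3 : ∀ᵐ x ∂unitVol, ∀ j, shift p ((n : ℝ) - t) (f j) x =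
      zeroExt (f j) (x + ((n : ℝ) - t)) := ae_all_iff.2 fun j => coeFn_shift _ _
    filter_upwards [h3, coeFn_tens (B ^ n) (shift p ((n : ℝ) - t)) f i] with x hx hx'
    rw [hx']
    exact Finset.sum_congr rfl fun j _ => by rw [hx]
  filter_upwards [h1, h2, ae_unitVol_mem] with x hx1 hx2 hx n hn i
  rw [hx1, Finset.sum_eq_single n]
  · rw [hx2]
    exact Finset.sum_congr rfl fun j _ => by rw [zeroExt_of_mem hn]
  · intro m _ hm
    rw [hx2]
    refine Finset.sum_eq_zero fun j _ => ?_
    rw [zeroExt_of_notMem, mul_zero]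
    intro hm'
    have h4 : (m : ℝ) < n + 1 := by linarith [hm'.2, hn.1]
    have h5 : (n : ℝ) < m + 1 := by linarith [hm'.1, hn.2]
    have h6 : m < n + 1 := by exact_mod_cast h4
    have h7 : n < m + 1 := by exact_mod_cast h5
    omega
  · intro h
    exfalso
    apply h
    rw [Finset.mem_range]
    have : (n : ℝ) < N := by linarith [hn.2, hx.1]
    exact_mod_cast this

theorem transport_zero : transport p B 0 = ContinuousLinearMap.id ℂ _ := by
  simp [transport, shift_zero, tens_one]

theorem transport_add (s t : ℝ≥0) :
    transport p B (s + t) = (transport p B s).comp (transport p B t) := by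
  ext1 f
  refine PiLp.ext fun i => Lp.ext ?_
  have h1 := fun m : ℕ => ae_unitVol_add (transport_apply_ae p B t f) ((m : ℝ) - s)
  have h2 := fun m : ℕ => ae_unitVol_add (exists_branch_ae t) ((m : ℝ) - s)
  filter_upwards [transport_apply_ae p B (s + t) f, transport_apply_ae p B s (transport p B t f),
    exists_branch_ae s, ae_restrict_of_ae (ae_all_iff.2 h1), ae_restrict_of_ae (ae_all_iff.2 h2)]
    with x hx1 hx2 ⟨m, hm⟩ hx3 hx4
  obtain ⟨n, hn⟩ := hx4 m hm
  -- Branch m for time s followed by branch n for time t is branch m + n for time s + t.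
  have e : x + ((m : ℝ) - s) + ((n : ℝ) - t) = x + (((m + n : ℕ) : ℝ) - ((s + t : ℝ≥0) : ℝ)) := by
    push_cast; ring
  rw [ContinuousLinearMap.comp_apply, hx2 m hm, hx1 (m + n) (e ▸ hn)]
  simp_rw [hx3 m hm n hn, e, pow_add, Matrix.mul_apply, Finset.sum_mul, Finset.mul_sum]
  rw [Finset.sum_comm]
  simp_rw [mul_assoc]

theorem isC0Semigroup_transport (hp : p ≠ ⊤) : IsC0Semigroup (transport p B) where
  map_zero := transport_zero p B
  map_add := transport_add p B
  continuous f := by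
    rw [continuous_iff_continuousAt]
    intro t
    obtain ⟨N, hN⟩ := exists_nat_ge ((t : ℝ) + 2)
    have h1 : Continuous fun s : ℝ≥0 =>
        ∑ n ∈ Finset.range N, tens p (B ^ n) (shift p ((n : ℝ) - s)) f :=
      continuous_finsetSum _ fun n _ => continuous_tens_apply _
        (fun g => (continuous_shift hp g).comp
          (continuous_const.sub NNReal.continuous_coe)) f
    refine h1.continuousAt.congr ?_
    have h2 : ∀ᶠ s : ℝ≥0 in 𝓝 t, s < t + 1 := eventually_lt_nhds (by simp)
    filter_upwards [h2] with s hs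
    have hs' : (s : ℝ) < t + 1 := by exact_mod_cast hs
    rw [transport_eq_sum_range p B (N := N) (by linarith), sum_apply]

theorem transport_eq_of_lt_one {t : ℝ≥0} (ht : t < 1) : transport p B t =
    tens p 1 (shift p (-(t : ℝ))) + tens p B (shift p (1 - (t : ℝ))) := by
  have ht' : (t : ℝ) < 1 := by exact_mod_cast ht
  rw [transport_eq_sum_range p B (N := 2) (by push_cast; linarith)]
  simp [Finset.sum_range_succ]

end Transport

/-! ### Primitives and translation-invariant functions -/

section Primitive

/-- The primitive of the zero extension of a function on `(0,1)` that vanishes at `0`. -/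
def primitive (g : ℝ → ℂ) (x : ℝ) : ℂ := ∫ y in (0 : ℝ)..x, zeroExt g y

variable {p : ℝ≥0∞} [Fact (1 ≤ p)]

theorem intervalIntegrable_zeroExt (g : Lp ℂ p unitVol) (a b : ℝ) :
    IntervalIntegrable (zeroExt g) volume a b :=
  (integrable_zeroExt g).intervalIntegrable

theorem continuous_primitive (g : Lp ℂ p unitVol) : Continuous (primitive g) :=
  intervalIntegral.continuous_primitive (fun a b => intervalIntegrable_zeroExt g a b) 0

theorem primitive_of_nonpos (g : ℝ → ℂ) {x : ℝ} (hx : x ≤ 0) : primitive g x = 0 := by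
  refine intervalIntegral.integral_zero_ae (Eventually.of_forall fun y hy => ?_)
  rw [uIoc_of_ge hx] at hy
  exact zeroExt_of_notMem fun h => by linarith [h.1, hy.2]

theorem primitive_of_one_le (g : Lp ℂ p unitVol) {x : ℝ} (hx : 1 ≤ x) :
    primitive g x = primitive g 1 := by
  have h := intervalIntegral.integral_add_adjacent_intervals
    (intervalIntegrable_zeroExt g 0 1) (intervalIntegrable_zeroExt g 1 x)
  have h0 : ∫ y in (1 : ℝ)..x, zeroExt g y = 0 := by
    refine intervalIntegral.integral_zero_ae (Eventually.of_forall fun y hy => ?_)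
    rw [uIoc_of_le hx] at hy
    exact zeroExt_of_notMem fun h => by linarith [h.2, hy.1]
  rw [primitive, primitive, ← h, h0, add_zero]

theorem integral_zeroExt_comp_sub (g : Lp ℂ p unitVol) (x t r : ℝ) :
    ∫ s in (0 : ℝ)..t, zeroExt g (x + (r - s)) = primitive g (x + r) - primitive g (x + r - t) := by
  have h1 := intervalIntegral.integral_comp_sub_left (a := 0) (b := t) (zeroExt g) (x + r)
  have h2 := intervalIntegral.integral_add_adjacent_intervals
    (intervalIntegrable_zeroExt g 0 (x + r - t)) (intervalIntegrable_zeroExt g (x + r - t) (x + r))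
  simp_rw [← add_sub_assoc]
  rw [h1, sub_zero, primitive, primitive, ← h2, add_sub_cancel_left]

/-- A function on `(0,1)` that is invariant under all translations is constant. -/
theorem exists_ae_eq_const {F : ℝ → ℂ} (hF : StronglyMeasurable F)
    (h : ∀ t ∈ Ioo (0 : ℝ) 1, ∀ᵐ x ∂unitVol, x - t ∈ Ioo (0 : ℝ) 1 → F (x - t) = F x) :
    ∃ c, ∀ᵐ x ∂unitVol, F x = c := by
  have hFm := hF.measurable
  have h1 : ∀ᵐ t : ℝ, ∀ᵐ x : ℝ, t ∈ Ioo (0 : ℝ) 1 → x ∈ Ioo (0 : ℝ) 1 → x - t ∈ Ioo (0 : ℝ) 1 →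
      F (x - t) = F x := by
    refine Eventually.of_forall fun t => ?_
    by_cases ht : t ∈ Ioo (0 : ℝ) 1
    · filter_upwards [ae_unitVol_iff.1 (h t ht)] with x hx _ using hx
    · exact Eventually.of_forall fun x hx => absurd hx ht
  have hm1 : MeasurableSet {q : ℝ × ℝ | q.1 ∈ Ioo (0 : ℝ) 1 → q.2 ∈ Ioo (0 : ℝ) 1 →
      q.2 - q.1 ∈ Ioo (0 : ℝ) 1 → F (q.2 - q.1) = F q.2} := by
    have a1 : MeasurableSet {q : ℝ × ℝ | q.1 ∈ Ioo (0 : ℝ) 1} := measurable_fst measurableSet_Ioo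
    have a2 : MeasurableSet {q : ℝ × ℝ | q.2 ∈ Ioo (0 : ℝ) 1} := measurable_snd measurableSet_Ioo
    have a3 : MeasurableSet {q : ℝ × ℝ | q.2 - q.1 ∈ Ioo (0 : ℝ) 1} :=
      (measurable_snd.sub measurable_fst) measurableSet_Ioo
    have a4 : MeasurableSet {q : ℝ × ℝ | F (q.2 - q.1) = F q.2} :=
      measurableSet_eq_fun (hFm.comp (measurable_snd.sub measurable_fst)) (hFm.comp measurable_snd)
    exact a1.imp (a2.imp (a3.imp a4))
  -- Fubini turns an exceptional set of x for each t into an exceptional set of t for almost every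
  -- x; substituting y = x - t then compares F at almost all pairs.
  rw [Measure.ae_ae_comm hm1] at h1
  have h2 : ∀ᵐ x ∂unitVol, ∀ᵐ y ∂unitVol, y < x → F y = F x := by
    rw [ae_unitVol_iff]
    filter_upwards [h1] with x hx hx0
    rw [ae_unitVol_iff]
    filter_upwards [(volume.measurePreserving_sub_left x).quasiMeasurePreserving.ae hx]
      with y hy hy0 hyx
    have := hy ⟨by linarith, by linarith [hy0.1, hx0.2]⟩ hx0 (by rwa [sub_sub_cancel])
    rwa [sub_sub_cancel] at this
  have hm2 : MeasurableSet {q : ℝ × ℝ | q.2 < q.1 → F q.2 = F q.1} :=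
    (measurableSet_lt measurable_snd measurable_fst).imp
      (measurableSet_eq_fun (hFm.comp measurable_snd) (hFm.comp measurable_fst))
  have h3 := (Measure.ae_ae_comm hm2).1 h2
  obtain ⟨x, hx1, hx2⟩ := (h2.and h3).exists
  refine ⟨F x, ?_⟩
  have h4 : ∀ᵐ y ∂unitVol, y ≠ x := ae_restrict_of_ae (Measure.ae_ne volume x)
  filter_upwards [hx1, hx2, h4] with y hy1 hy2 hyx
  rcases lt_or_gt_of_ne hyx with h | h
  · exact hy1 h
  · exact (hy2 h).symm

end Primitive

/-! ### The generator of the transport semigroup in integrated form -/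

section Generator

variable {p : ℝ≥0∞} [Fact (1 ≤ p)] {J : Type*} [Fintype J]

/-- The integrated form of `-f' = g`, `f(0) = B f(1)`. -/
def IntegratedEq (B : Matrix J J ℂ) (f g : XSpace p J) : Prop :=
  ∃ c : J → ℂ, (∀ i, ∀ᵐ x ∂unitVol, f i x = c i - primitive (g i) x) ∧
    c = B.mulVec fun j => c j - primitive (g j) 1

variable [DecidableEq J]

theorem integral_transport_ae (hp : p ≠ ⊤) (B : Matrix J J ℂ) (g : XSpace p J) {t : ℝ}
    (ht : t ∈ Ioo (0 : ℝ) 1) (i : J) :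
    ∀ᵐ x ∂unitVol, orbitIntegral (transport p B) g t i x =
      primitive (g i) x - primitive (g i) (x - t) +
        ∑ j, B i j * (primitive (g j) (x + 1) - primitive (g j) (x + 1 - t)) := by
  have hcs : ∀ (r : ℝ) (j : J), IntervalIntegrable (fun s => shift p (r - s) (g j)) volume 0 t :=
    fun r j => ((continuous_shift hp (g j)).comp
      (continuous_const.sub continuous_id)).intervalIntegrable _ _
  have h1 : orbitIntegral (transport p B) g t i =
      (1 : ℂ) • (∫ s in (0 : ℝ)..t, shift p (0 - s) (g i)) +
        ∑ j, B i j • ∫ s in (0 : ℝ)..t, shift p (1 - s) (g j) := by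
    have e1 := (PiLp.proj (𝕜 := ℂ) p (fun _ : J => Lp ℂ p unitVol) i).intervalIntegral_comp_comm
      (((isC0Semigroup_transport p B hp).continuous_orbit g).intervalIntegrable (μ := volume) 0 t)
    change _ = orbitIntegral (transport p B) g t i at e1
    rw [← e1]
    have e2 : ∀ s ∈ uIcc 0 t, PiLp.proj (𝕜 := ℂ) p (fun _ : J => Lp ℂ p unitVol) i
        (transport p B s.toNNReal g) = shift p (0 - s) (g i) +
          ∑ j, B i j • shift p (1 - s) (g j) := by
      intro s hs
      rw [uIcc_of_le ht.1.le] at hs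
      rw [transport_eq_of_lt_one p B (by rw [Real.toNNReal_lt_one]; linarith [hs.2, ht.2]),
        Real.coe_toNNReal _ hs.1]
      change tens p 1 (shift p (-s)) g i + tens p B (shift p (1 - s)) g i = _
      rw [tens_apply, tens_apply]
      simp [Matrix.one_apply]
    rw [intervalIntegral.integral_congr e2, intervalIntegral.integral_add (hcs 0 i),
      intervalIntegral.integral_finsetSum]
    · simp [intervalIntegral.integral_smul]
    · exact fun j _ => (hcs 1 j).smul (B i j)
    · have hcj : ∀ j, Continuous fun s => shift p (1 - s) (g j) := fun j =>
        (continuous_shift hp (g j)).comp (continuous_const.sub continuous_id)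
      exact Continuous.intervalIntegrable
        (continuous_finsetSum _ fun j _ => (hcj j).const_smul (B i j)) _ _
  rw [h1, one_smul]
  have h2 : ∀ᵐ x ∂unitVol, ∀ j, (∫ s in (0 : ℝ)..t, shift p (1 - s) (g j)) x =
      ∫ s in (0 : ℝ)..t, zeroExt (g j) (x + (1 - s)) :=
    ae_all_iff.2 fun j => coeFn_integral_shift hp (g j) 0 t 1
  filter_upwards [h2, coeFn_integral_shift hp (g i) 0 t 0,
    Lp.coeFn_add (∫ s in (0 : ℝ)..t, shift p (0 - s) (g i))
      (∑ j, B i j • ∫ s in (0 : ℝ)..t, shift p (1 - s) (g j)),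
    coeFn_sum_smul Finset.univ (fun j => B i j)
      (fun j => ∫ s in (0 : ℝ)..t, shift p (1 - s) (g j))] with x hx1 hx2 hx3 hx4
  rw [hx3, Pi.add_apply, hx2, hx4, integral_zeroExt_comp_sub, add_zero]
  simp_rw [hx1, integral_zeroExt_comp_sub]

theorem ae_transport_sub (B : Matrix J J ℂ) (f : XSpace p J) (t : ℝ≥0) (i : J) :
    ∀ᵐ x ∂unitVol, (transport p B t f - f) i x = transport p B t f i x - f i x :=
  Lp.coeFn_sub _ _

/-- For 0 < t < 1 the identity T(t)f - f = ∫₀ᵗ T(s)g is read off on two branches. Where x > t it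
says that f plus the primitive of g is translation invariant, hence a constant c; where x < t it
expresses the boundary condition on c. -/
theorem isGenPair_transport_iff (hp : p ≠ ⊤) (B : Matrix J J ℂ) (f g : XSpace p J) :
    IsGenPair (transport p B) f g ↔ IntegratedEq B f g := by
  have hT := isC0Semigroup_transport p B hp
  constructor
  · intro h
    have key : ∀ t ∈ Ioo (0 : ℝ) 1, ∀ᵐ x ∂unitVol, ∀ i,
        transport p B t.toNNReal f i x - f i x =
        primitive (g i) x - primitive (g i) (x - t) +
          ∑ j, B i j * (primitive (g j) (x + 1) - primitive (g j) (x + 1 - t)) := by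
      intro t ht
      refine ae_all_iff.2 fun i => ?_
      have e := hT.apply_sub_eq_integral h ht.1.le
      filter_upwards [integral_transport_ae hp B g ht i, ae_transport_sub B f t.toNNReal i]
        with x hx1 hx2
      rw [← hx2, ← hx1, e]
    have hc : ∀ i, ∃ c, ∀ᵐ x ∂unitVol, f i x + primitive (g i) x = c := by
      intro i
      refine exists_ae_eq_const (F := fun x => f i x + primitive (g i) x)
        ((Lp.stronglyMeasurable _).add (continuous_primitive _).stronglyMeasurable) fun t ht => ?_
      filter_upwards [key t ht, transport_apply_ae p B t.toNNReal f, ae_unitVol_mem]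
        with x hx1 hx2 hx hxt
      have e : x + (((0 : ℕ) : ℝ) - (t.toNNReal : ℝ)) = x - t := by
        rw [Real.coe_toNNReal _ ht.1.le]; push_cast; ring
      have h1 := hx2 0 (by rwa [e]) i
      have h2 := hx1 i
      rw [e, pow_zero] at h1
      -- On branch 0 both arguments are at least 1, where the primitive is constant, so the boundary
      -- matrix drops out.
      have h3 : ∑ j, B i j * (primitive (g j) (x + 1) - primitive (g j) (x + 1 - t)) = 0 := by
        refine Finset.sum_eq_zero fun j _ => ?_
        rw [primitive_of_one_le _ (by linarith [hx.1]),
          primitive_of_one_le _ (by linarith [hxt.1] : 1 ≤ x + 1 - t), sub_self, mul_zero]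
      rw [h1, h3] at h2
      simp only [Matrix.one_apply, ite_mul, one_mul, zero_mul, Finset.sum_ite_eq,
        Finset.mem_univ, if_true] at h2
      linear_combination h2
    choose c hc using hc
    have hc' : ∀ i, ∀ᵐ x ∂unitVol, f i x = c i - primitive (g i) x := fun i => by
      filter_upwards [hc i] with x hx
      rw [← hx]; ring
    refine ⟨c, hc', ?_⟩
    -- The boundary condition is a statement about constants, so one point suffices. At time 1/2
    -- every x in (0,1/2) is on branch 1, and this interval has positive measure, so it meets the
    -- set where all almost-everywhere identities hold.
    have hh : (1 / 2 : ℝ) ∈ Ioo (0 : ℝ) 1 := by norm_num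
    have hall : ∀ᵐ x ∂unitVol, ∀ i, f i x = c i - primitive (g i) x := ae_all_iff.2 hc'
    have hsh := ae_restrict_of_ae (s := Ioo (0 : ℝ) 1)
      (ae_unitVol_add hall (((1 : ℕ) : ℝ) - ((1 / 2 : ℝ).toNNReal : ℝ)))
    obtain ⟨x, hx0, hx1, hx2, hx3, hx4⟩ : ∃ x ∈ Ioo (0 : ℝ) (1 / 2),
        (∀ i, transport p B (1 / 2 : ℝ).toNNReal f i x - f i x =
        primitive (g i) x - primitive (g i) (x - 1 / 2) +
          ∑ j, B i j * (primitive (g j) (x + 1) - primitive (g j) (x + 1 - 1 / 2))) ∧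
        (∀ n : ℕ, x + ((n : ℝ) - ((1 / 2 : ℝ).toNNReal : ℝ)) ∈ Ioo (0 : ℝ) 1 → ∀ i,
          transport p B (1 / 2 : ℝ).toNNReal f i x =
            ∑ j, (B ^ n) i j * f j (x + ((n : ℝ) - ((1 / 2 : ℝ).toNNReal : ℝ)))) ∧
        (∀ i, f i x = c i - primitive (g i) x) ∧
        (x + (((1 : ℕ) : ℝ) - ((1 / 2 : ℝ).toNNReal : ℝ)) ∈ Ioo (0 : ℝ) 1 → ∀ i,
          f i (x + (((1 : ℕ) : ℝ) - ((1 / 2 : ℝ).toNNReal : ℝ))) =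
            c i - primitive (g i) (x + (((1 : ℕ) : ℝ) - ((1 / 2 : ℝ).toNNReal : ℝ)))) := by
      by_contra hne
      push Not at hne
      have : ∀ᵐ x ∂unitVol, x ∉ Ioo (0 : ℝ) (1 / 2) := by
        filter_upwards [key _ hh, transport_apply_ae p B (1 / 2 : ℝ).toNNReal f, hall, hsh]
          with x y1 y2 y3 y4 y0
        obtain ⟨y5, i, y6⟩ := hne x y0 y1 y2 y3
        exact y6 (y4 y5 i)
      have h0 := ae_iff.1 this
      simp only [not_not, ofPred_mem_eq] at h0
      rw [Measure.restrict_apply measurableSet_Ioo, Ioo_inter_Ioo] at h0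
      norm_num at h0
    have e : x + (((1 : ℕ) : ℝ) - ((1 / 2 : ℝ).toNNReal : ℝ)) = x + 1 - 1 / 2 := by
      rw [Real.coe_toNNReal _ hh.1.le]; push_cast; ring
    have hm : x + 1 - 1 / 2 ∈ Ioo (0 : ℝ) 1 := ⟨by linarith [hx0.1], by linarith [hx0.2]⟩
    funext i
    have h1 := hx1 i
    have h2 := hx2 1 (e ▸ hm) i
    rw [e] at hx4
    rw [e, pow_one] at h2
    rw [h2, hx3, primitive_of_nonpos _ (by linarith [hx0.2] : x - 1 / 2 ≤ 0)] at h1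
    simp_rw [hx4 hm] at h1
    have e3 : ∀ j, primitive (g j) (x + 1) = primitive (g j) 1 := fun j =>
      primitive_of_one_le _ (by linarith [hx0.1])
    simp_rw [e3] at h1
    have e4 : ∑ j, B i j * (c j - primitive (g j) (x + 1 - 1 / 2)) -
        ∑ j, B i j * (primitive (g j) 1 - primitive (g j) (x + 1 - 1 / 2)) =
        ∑ j, B i j * (c j - primitive (g j) 1) := by
      rw [← Finset.sum_sub_distrib]
      exact Finset.sum_congr rfl fun j _ => by ring
    change c i = ∑ j, B i j * (c j - primitive (g j) 1)
    rw [← e4]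
    linear_combination -h1
  · rintro ⟨c, hc, hB⟩
    refine hT.isGenPair_of_integral one_pos fun t ht0 ht1 => ?_
    have ht : t ∈ Ioo (0 : ℝ) 1 := ⟨ht0, ht1⟩
    have hall : ∀ᵐ x ∂unitVol, ∀ i, f i x = c i - primitive (g i) x := ae_all_iff.2 hc
    have hsh := fun n : ℕ => ae_unitVol_add hall ((n : ℝ) - (t.toNNReal : ℝ))
    refine PiLp.ext fun i => Lp.ext ?_
    filter_upwards [integral_transport_ae hp B g ht i, ae_transport_sub B f t.toNNReal i,
      transport_apply_ae p B t.toNNReal f, exists_branch_ae t.toNNReal, hall,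
      ae_restrict_of_ae (ae_all_iff.2 hsh), ae_unitVol_mem] with x hx1 hx2 hx3 ⟨n, hn⟩ hx4 hx5 hx
    rw [hx2, hx1, hx3 n hn i, hx4]
    simp_rw [hx5 n hn]
    rw [Real.coe_toNNReal _ ht.1.le] at hn ⊢
    have hn2 : n < 2 := by
      have : (n : ℝ) < 2 := by linarith [hn.2, hx.1]
      exact_mod_cast this
    have e3 : ∀ j, primitive (g j) (x + 1) = primitive (g j) 1 := fun j =>
      primitive_of_one_le _ (by linarith [hx.1])
    simp_rw [e3]
    -- Branch 0 is x > t, branch 1 is x < t.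
    interval_cases n
    · have e : x + (((0 : ℕ) : ℝ) - t) = x - t := by push_cast; ring
      rw [e] at hn ⊢
      have e4 : ∀ j, primitive (g j) (x + 1 - t) = primitive (g j) 1 := fun j =>
        primitive_of_one_le _ (by linarith [hn.1])
      simp only [e4, sub_self, mul_zero, Finset.sum_const_zero, pow_zero, Matrix.one_apply,
        ite_mul, one_mul, zero_mul, Finset.sum_ite_eq, Finset.mem_univ, if_true]
      ring
    · have e : x + (((1 : ℕ) : ℝ) - t) = x + 1 - t := by push_cast; ring
      rw [e] at hn ⊢
      rw [pow_one, primitive_of_nonpos _ (by linarith [hn.2] : x - t ≤ 0)]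
      have hBi : c i = ∑ j, B i j * (c j - primitive (g j) 1) := congrFun hB i
      have e4 : ∑ j, B i j * (c j - primitive (g j) (x + 1 - t)) -
          ∑ j, B i j * (primitive (g j) 1 - primitive (g j) (x + 1 - t)) =
          ∑ j, B i j * (c j - primitive (g j) 1) := by
        rw [← Finset.sum_sub_distrib]
        exact Finset.sum_congr rfl fun j _ => by ring
      rw [← hBi] at e4
      linear_combination e4

end Generator

/-! ### Weak derivatives and boundary values -/

section WeakDerivative

theorem HasWeakDeriv.congr_ae {u v u' v' : ℝ → ℂ} (h : HasWeakDeriv u v) (hu : u =ᵐ[unitVol] u')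
    (hv : v =ᵐ[unitVol] v') : HasWeakDeriv u' v' := by
  intro φ h1 h2 h3
  have e1 : ∫ x in Ioo (0 : ℝ) 1, deriv φ x • u' x = ∫ x in Ioo (0 : ℝ) 1, deriv φ x • u x :=
    integral_congr_ae (hu.mono fun x hx => by simp only [hx])
  have e2 : ∫ x in Ioo (0 : ℝ) 1, φ x • v' x = ∫ x in Ioo (0 : ℝ) 1, φ x • v x :=
    integral_congr_ae (hv.mono fun x hx => by simp only [hx])
  rw [e1, e2]
  exact h φ h1 h2 h3

theorem integral_reflect (F : ℝ → ℂ) :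
    ∫ x in Ioo (0 : ℝ) 1, F (1 - x) = ∫ x in Ioo (0 : ℝ) 1, F x :=
  measurePreserving_reflect.integral_comp (MeasurableEquiv.subLeft (1 : ℝ)).measurableEmbedding F

theorem HasWeakDeriv.reflect {u v : ℝ → ℂ} (h : HasWeakDeriv u v) :
    HasWeakDeriv (fun x => u (1 - x)) (fun x => -v (1 - x)) := by
  intro φ h1 h2 h3
  have hψ := h (fun x => φ (1 - x)) (h1.comp (contDiff_const.sub contDiff_id))
    (h2.comp_homeomorph (Homeomorph.subLeft (1 : ℝ))) (by
      intro x hx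
      have := tsupport_comp_subset_preimage φ (f := fun x : ℝ => 1 - x) (by fun_prop) hx
      have := h3 this
      exact ⟨by linarith [this.2], by linarith [this.1]⟩)
  rw [← integral_reflect, ← integral_reflect (fun x => φ x • -v (1 - x))]
  simp only [sub_sub_cancel, smul_neg, integral_neg, neg_neg]
  have hd : ∀ x, deriv (fun x => φ (1 - x)) x = -deriv φ (1 - x) := fun x => by
    rw [deriv_comp_const_sub]
  simp only [hd, neg_smul, integral_neg] at hψ
  exact neg_injective hψ

theorem integral_Ioo_deriv_smul {φ : ℝ → ℝ} (h : tsupport φ ⊆ Ioo 0 1) (u : ℝ → ℂ) :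
    ∫ x in Ioo (0 : ℝ) 1, deriv φ x • u x = ∫ x, deriv φ x • u x := by
  refine setIntegral_eq_integral_of_forall_compl_eq_zero fun x hx => ?_
  have : deriv φ x = 0 := by
    by_contra hne
    exact hx (h (support_deriv_subset hne))
  rw [this, zero_smul]

theorem integral_Ioo_smul {φ : ℝ → ℝ} (h : tsupport φ ⊆ Ioo 0 1) (u : ℝ → ℂ) :
    ∫ x in Ioo (0 : ℝ) 1, φ x • u x = ∫ x, φ x • u x := by
  refine setIntegral_eq_integral_of_forall_compl_eq_zero fun x hx => ?_
  have : φ x = 0 := by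
    by_contra hne
    exact hx (h (subset_tsupport φ hne))
  rw [this, zero_smul]

/-- Written as an integral over the whole line of an indicator, the primitive is ready for Fubini on
the region y < x. -/
theorem primitive_eq_integral (g : ℝ → ℂ) (x : ℝ) :
    primitive g x = ∫ y, (Iio x).indicator (zeroExt g) y := by
  rw [integral_indicator measurableSet_Iio]
  rcases le_or_gt x 0 with hx | hx
  · rw [primitive_of_nonpos _ hx]
    symm
    refine setIntegral_eq_zero_of_forall_eq_zero fun y hy => zeroExt_of_notMem fun h => ?_
    have : y < x := hy
    linarith [h.1]
  · rw [primitive, intervalIntegral.integral_of_le hx.le, integral_Ioc_eq_integral_Ioo]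
    symm
    exact setIntegral_eq_of_subset_of_forall_sdiff_eq_zero measurableSet_Iio
      (fun y hy => hy.2) fun y hy => zeroExt_of_notMem fun h => hy.2 ⟨h.1, hy.1⟩

variable {p : ℝ≥0∞} [Fact (1 ≤ p)]

theorem integral_deriv_smul_primitive (g : Lp ℂ p unitVol) {φ : ℝ → ℝ} (h1 : ContDiff ℝ ∞ φ)
    (h2 : HasCompactSupport φ) :
    ∫ x, deriv φ x • primitive g x = -∫ x, φ x • zeroExt g x := by
  have hd : Continuous (deriv φ) := h1.continuous_deriv (by simp)
  have hdi : Integrable (fun x => ((deriv φ x : ℝ) : ℂ)) volume :=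
    (hd.integrable_of_hasCompactSupport h2.deriv).ofReal
  have hS : MeasurableSet {q : ℝ × ℝ | q.2 < q.1} := measurableSet_lt measurable_snd measurable_fst
  have hint := (hdi.mul_prod (integrable_zeroExt g)).indicator hS
  have hswap := integral_integral_swap (f := fun x y =>
    {q : ℝ × ℝ | q.2 < q.1}.indicator (fun q : ℝ × ℝ => ((deriv φ q.1 : ℝ) : ℂ) * zeroExt g q.2) (x, y))
    hint
  have e1 : ∀ x, ∫ y, {q : ℝ × ℝ | q.2 < q.1}.indicator
      (fun q : ℝ × ℝ => ((deriv φ q.1 : ℝ) : ℂ) * zeroExt g q.2) (x, y) =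
      deriv φ x • primitive g x := by
    intro x
    rw [primitive_eq_integral, ← integral_smul]
    refine integral_congr_ae (Eventually.of_forall fun y => ?_)
    by_cases hy : y < x
    · simp [indicator, hy]
    · simp [indicator, hy]
  have e2 : ∀ y, ∫ x, {q : ℝ × ℝ | q.2 < q.1}.indicator
      (fun q : ℝ × ℝ => ((deriv φ q.1 : ℝ) : ℂ) * zeroExt g q.2) (x, y) =
      -(φ y • zeroExt g y) := by
    intro y
    have : ∀ x, {q : ℝ × ℝ | q.2 < q.1}.indicator
      (fun q : ℝ × ℝ => ((deriv φ q.1 : ℝ) : ℂ) * zeroExt g q.2) (x, y) =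
        (Ioi y).indicator (fun x => ((deriv φ x : ℝ) : ℂ)) x * zeroExt g y := by
      intro x
      by_cases hy : y < x
      · simp [indicator, hy]
      · simp [indicator, hy]
    simp_rw [this]
    rw [integral_mul_const, integral_indicator measurableSet_Ioi, integral_complex_ofReal,
      HasCompactSupport.integral_Ioi_deriv_eq (h1.of_le (by simp)) h2]
    simp
  simp_rw [e1, e2] at hswap
  rw [hswap, integral_neg]

theorem hasWeakDeriv_of_ae_eq (g : Lp ℂ p unitVol) (c : ℂ) {u : ℝ → ℂ}
    (hu : ∀ᵐ x ∂unitVol, u x = c - primitive g x) : HasWeakDeriv u (-g) := by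
  have hu' : (fun x => c - primitive g x) =ᵐ[unitVol] u := hu.mono fun x hx => hx.symm
  refine HasWeakDeriv.congr_ae (u := fun x => c - primitive g x) (v := -g) ?_ hu'
    (EventuallyEq.refl _ _)
  intro φ h1 h2 h3
  have hd : Continuous (deriv φ) := h1.continuous_deriv (by simp)
  have i1 : Integrable (fun x => deriv φ x • c) :=
    (hd.smul continuous_const).integrable_of_hasCompactSupport h2.deriv.smul_right
  have i2 : Integrable (fun x => deriv φ x • primitive g x) :=
    (hd.smul (continuous_primitive g)).integrable_of_hasCompactSupport h2.deriv.smul_right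
  rw [integral_Ioo_deriv_smul h3]
  simp_rw [smul_sub]
  rw [integral_sub i1 i2, integral_deriv_smul_primitive g h1 h2, integral_smul_const]
  have h0 : ∫ x, deriv φ x = 0 := by
    rw [integral_eq_zero_of_hasDerivAt_of_integrable
      (fun x => (h1.differentiable (by simp) x).hasDerivAt)
      (hd.integrable_of_hasCompactSupport h2.deriv)
      (h1.continuous.integrable_of_hasCompactSupport h2)]
  rw [h0, zero_smul, zero_sub, neg_neg, ← integral_Ioo_smul h3]
  simp only [Pi.neg_apply, smul_neg, integral_neg, neg_neg]
  exact setIntegral_congr_fun measurableSet_Ioo fun x hx => by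
    rw [zeroExt_of_mem hx]

/-- The lemma of du Bois-Reymond. -/
theorem ae_const_of_hasWeakDeriv_zero {w : ℝ → ℂ} (hw : Integrable w unitVol)
    (h : HasWeakDeriv w 0) : ∃ c, ∀ᵐ x ∂unitVol, w x = c := by
  -- A normalized bump supported in [1/4, 3/4]; the constant will be the mean of w weighted by it.
  let b : ContDiffBump (1 / 2 : ℝ) := ⟨1 / 8, 1 / 4, by norm_num, by norm_num⟩
  set η : ℝ → ℝ := b.normed volume with hη
  have hη1 : ContDiff ℝ ∞ η := b.contDiff_normed
  have hη2 : HasCompactSupport η := b.hasCompactSupport_normed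
  have hη3 : tsupport η ⊆ Icc (1 / 4 : ℝ) (3 / 4) := by
    rw [hη, b.tsupport_normed_eq, Real.closedBall_eq_Icc]
    refine Icc_subset_Icc ?_ ?_ <;> norm_num [b]
  have hη4 : ∫ x, η x = 1 := b.integral_normed
  set c : ℂ := ∫ x in Ioo (0 : ℝ) 1, η x • w x with hc
  refine ⟨c, ?_⟩
  have hwc : Integrable (fun x => w x - c) unitVol := hw.sub (integrable_const c)
  have hmulint : ∀ ψ : ℝ → ℝ, ContDiff ℝ ∞ ψ → HasCompactSupport ψ →
      Integrable (fun x => ψ x • w x) unitVol := fun ψ h1 h2 => by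
    obtain ⟨C, hC⟩ := h2.exists_bound_of_continuous h1.continuous
    exact hw.bdd_smul C h1.continuous.aestronglyMeasurable (Eventually.of_forall hC)
  have key := isOpen_Ioo.ae_eq_zero_of_integral_contDiff_smul_eq_zero (U := Ioo (0 : ℝ) 1)
    (μ := volume) (f := fun x => w x - c) (IntegrableOn.locallyIntegrableOn hwc) ?_
  · rw [ae_unitVol_iff]
    filter_upwards [key] with x hx hx0
    exact sub_eq_zero.1 (hx hx0)
  intro ψ h1 h2 h3
  set m : ℝ := ∫ x, ψ x with hm
  -- Removing the multiple mη gives integral zero, so the primitive of θ again has compact support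
  -- in (0,1) and is an admissible test function.
  set θ : ℝ → ℝ := fun x => ψ x - m * η x with hθ
  have hθ1 : ContDiff ℝ ∞ θ := h1.sub (contDiff_const.mul hη1)
  have hθ0 : ∫ x, θ x = 0 := by
    rw [integral_sub (h1.continuous.integrable_of_hasCompactSupport h2)
      ((hη1.continuous.integrable_of_hasCompactSupport hη2).const_mul m), integral_const_mul, hη4,
      mul_one, sub_self]
  obtain ⟨a, d, ha, hd, had⟩ : ∃ a d : ℝ, 0 < a ∧ d < 1 ∧ ∀ x, θ x ≠ 0 → x ∈ Icc a d := by
    have hK : IsCompact (tsupport ψ ∪ Icc (1 / 4 : ℝ) (3 / 4)) := h2.isCompact.union isCompact_Icc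
    have hne : (tsupport ψ ∪ Icc (1 / 4 : ℝ) (3 / 4)).Nonempty := ⟨1 / 2, Or.inr (by norm_num)⟩
    have hsub : tsupport ψ ∪ Icc (1 / 4 : ℝ) (3 / 4) ⊆ Ioo 0 1 :=
      union_subset h3 fun x hx => ⟨by linarith [hx.1], by linarith [hx.2]⟩
    refine ⟨sInf _, sSup _, (hsub (hK.sInf_mem hne)).1, (hsub (hK.sSup_mem hne)).2, fun x hx => ?_⟩
    have hxm : x ∈ tsupport ψ ∪ Icc (1 / 4 : ℝ) (3 / 4) := by
      by_contra hn
      rw [mem_union, not_or] at hn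
      apply hx
      have e1 : ψ x = 0 := image_eq_zero_of_notMem_tsupport hn.1
      have e2 : η x = 0 := image_eq_zero_of_notMem_tsupport fun h => hn.2 (hη3 h)
      simp [hθ, e1, e2]
    exact ⟨csInf_le hK.bddBelow hxm, le_csSup hK.bddAbove hxm⟩
  set φ : ℝ → ℝ := fun x => ∫ y in (0 : ℝ)..x, θ y with hφ
  have hder : ∀ x, HasDerivAt φ (θ x) x := fun x =>
    (hθ1.continuous.integral_hasStrictDerivAt 0 x).hasDerivAt
  have hderiv : deriv φ = θ := funext fun x => (hder x).deriv
  have hφ1 : ContDiff ℝ ∞ φ := by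
    rw [contDiff_infty_iff_deriv]
    exact ⟨fun x => (hder x).differentiableAt, hderiv ▸ hθ1⟩
  have hφ0 : ∀ x, x ∉ Icc a d → φ x = 0 := by
    intro x hx
    have hz : ∀ y, y ∉ Icc a d → θ y = 0 := fun y hy => by
      by_contra hne; exact hy (had y hne)
    rcases lt_or_ge x a with h' | h'
    · refine intervalIntegral.integral_zero_ae (Eventually.of_forall fun y hy => hz y fun hya => ?_)
      have : y ≤ max 0 x := hy.2
      have : max 0 x < a := max_lt ha h'
      linarith [hya.1]
    · have hdx : d < x := by
        by_contra hn; exact hx ⟨h', not_lt.1 hn⟩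
      have hx0 : 0 ≤ x := by linarith
      have : ∫ y in (0 : ℝ)..x, θ y = ∫ y, θ y := by
        rw [intervalIntegral.integral_of_le hx0]
        refine setIntegral_eq_integral_of_forall_compl_eq_zero fun y hy => hz y fun hya => ?_
        exact hy ⟨by linarith [hya.1], by linarith [hya.2]⟩
      rw [hφ]
      beta_reduce
      rw [this, hθ0]
  have hφs : tsupport φ ⊆ Icc a d := closure_minimal (fun x hx => by
    by_contra hn; exact hx (hφ0 x hn)) isClosed_Icc
  have hφ2 : HasCompactSupport φ := isCompact_Icc.of_isClosed_subset (isClosed_tsupport φ) hφs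
  have hweak := h φ hφ1 hφ2 (hφs.trans fun x hx => ⟨by linarith [hx.1], by linarith [hx.2]⟩)
  simp only [hderiv, Pi.zero_apply, smul_zero, integral_zero, neg_zero, hθ, sub_smul,
    mul_smul] at hweak
  have hmi : Integrable (fun x => m • η x • w x) unitVol := (hmulint η hη1 hη2).smul m
  rw [integral_sub (hmulint ψ h1 h2) hmi, integral_smul, ← hc] at hweak
  have hψ := integral_Ioo_smul h3 fun x => w x - c
  rw [← hψ]
  simp_rw [smul_sub]
  have hψi : Integrable (fun x => ψ x • c) :=
    (h1.continuous.integrable_of_hasCompactSupport h2).smul_const c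
  rw [integral_sub (hmulint ψ h1 h2) hψi.restrict, integral_Ioo_smul h3 fun _ => c,
    integral_smul_const]
  exact hweak

/-- The sum of u and the primitive of g has weak derivative zero, so du Bois-Reymond applies. -/
theorem exists_ae_eq_of_hasWeakDeriv {u : ℝ → ℂ} (hu : Integrable u unitVol)
    (g : Lp ℂ p unitVol) (h : HasWeakDeriv u (-g)) :
    ∃ c, ∀ᵐ x ∂unitVol, u x = c - primitive g x := by
  have hG : Integrable (primitive g) unitVol :=
    ((continuous_primitive g).integrableOn_Icc (a := 0) (b := 1)).mono_set Ioo_subset_Icc_self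
  have h0 := hasWeakDeriv_of_ae_eq g 0 (u := fun x => 0 - primitive g x)
    (Eventually.of_forall fun x => rfl)
  obtain ⟨c, hc⟩ := ae_const_of_hasWeakDeriv_zero (w := fun x => u x + primitive g x)
    (hu.add hG) (by
      intro φ h1 h2 h3
      have e1 := h φ h1 h2 h3
      have e2 := h0 φ h1 h2 h3
      obtain ⟨C, hC⟩ := h2.deriv.exists_bound_of_continuous (h1.continuous_deriv (by simp))
      have hm : ∀ v : ℝ → ℂ, Integrable v unitVol → Integrable (fun x => deriv φ x • v x) unitVol :=
        fun v hv => hv.bdd_smul C (h1.continuous_deriv (by simp)).aestronglyMeasurable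
          (Eventually.of_forall hC)
      simp only [zero_sub, smul_neg, integral_neg] at e2
      simp only [smul_add, Pi.zero_apply, smul_zero, integral_zero, neg_zero]
      rw [integral_add (hm _ hu) (hm _ hG), e1]
      rw [neg_eq_iff_eq_neg] at e2
      rw [e2, add_neg_cancel])
  refine ⟨c, hc.mono fun x hx => ?_⟩
  rw [← hx, add_sub_cancel_right]

theorem isContinuousRep_eqOn {U U' u : ℝ → ℂ} (h : IsContinuousRep U u)
    (h' : IsContinuousRep U' u) : EqOn U U' (Icc 0 1) := by
  refine Measure.eqOn_Icc_of_ae_eq volume zero_ne_one ?_ h.1 h'.1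
  rw [← restrict_Ioo_eq_restrict_Icc]
  exact h.2.trans h'.2.symm

variable {J : Type*} [Fintype J]

/-- The function c - `primitive` is the continuous representative, unique on [0,1]; its values at 0
and 1 are the two sides of the boundary condition. -/
theorem integratedEq_iff (B : Matrix J J ℂ) (f g : XSpace p J) :
    IntegratedEq B f g ↔ (∀ j, HasWeakDeriv (f j) (-(g j))) ∧ ∃ U : J → ℝ → ℂ,
      (∀ j, IsContinuousRep (U j) (f j)) ∧
        (fun j => U j 0) = B.mulVec fun j => U j 1 := by
  have h00 : ∀ j, primitive (g j) 0 = 0 := fun j => primitive_of_nonpos _ le_rfl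
  constructor
  · rintro ⟨c, hc, hB⟩
    refine ⟨fun j => hasWeakDeriv_of_ae_eq (g j) (c j) (hc j),
      fun j x => c j - primitive (g j) x, fun j => ⟨?_, ?_⟩, ?_⟩
    · exact (continuous_const.sub (continuous_primitive (g j))).continuousOn
    · exact (hc j).mono fun x hx => hx.symm
    · simp only [h00, sub_zero]
      exact hB
  · rintro ⟨hw, U, hU, hB⟩
    choose c hc using fun j => exists_ae_eq_of_hasWeakDeriv (integrable_Lp (f j)) (g j) (hw j)
    have hrep : ∀ j, EqOn (U j) (fun x => c j - primitive (g j) x) (Icc 0 1) := fun j =>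
      isContinuousRep_eqOn (hU j)
        ⟨(continuous_const.sub (continuous_primitive (g j))).continuousOn,
          (hc j).mono fun x hx => hx.symm⟩
    refine ⟨c, hc, ?_⟩
    have e0 : ∀ j, U j 0 = c j := fun j => by
      rw [hrep j (by simp)]; simp only [h00, sub_zero]
    have e1 : ∀ j, U j 1 = c j - primitive (g j) 1 := fun j => hrep j (by simp)
    simp only [e0, e1] at hB
    exact hB

end WeakDerivative

/-! ### Reflection to a system with a single flow direction -/

section Reflect

variable (p : ℝ≥0∞) {Jp Jm : Type*}

theorem coeFn_reflect_inr (f : XSpace p (Jp ⊕ Jm)) (i : Jm) :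
    ∀ᵐ x ∂unitVol, reflect p f (Sum.inr i) x = f (Sum.inr i) (1 - x) :=
  Lp.coeFn_compMeasurePreserving _ measurePreserving_reflect

theorem reflect_reflect (f : XSpace p (Jp ⊕ Jm)) : reflect p (reflect p f) = f := by
  refine PiLp.ext fun j => ?_
  rcases j with i | i
  · rfl
  · refine Lp.ext ?_
    filter_upwards [coeFn_reflect_inr p (reflect p f) i,
      ae_unitVol_reflect (coeFn_reflect_inr p f i)] with x h1 h2
    rw [h1, h2, sub_sub_cancel]

theorem IsContinuousRep.reflect {U u u' : ℝ → ℂ} (h : IsContinuousRep U u)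
    (hu : ∀ᵐ x ∂unitVol, u' x = u (1 - x)) : IsContinuousRep (fun x => U (1 - x)) u' := by
  refine ⟨h.1.comp (by fun_prop) fun x hx => ⟨by linarith [hx.2], by linarith [hx.1]⟩, ?_⟩
  filter_upwards [ae_unitVol_reflect h.2, hu] with x h1 h2
  rw [h1, h2]

theorem HasWeakDeriv.reflect_congr {u v u' v' : ℝ → ℂ} (h : HasWeakDeriv u v)
    (hu : ∀ᵐ x ∂unitVol, u' x = u (1 - x)) (hv : ∀ᵐ x ∂unitVol, v' x = -v (1 - x)) :
    HasWeakDeriv u' v' :=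
  h.reflect.congr_ae (hu.mono fun _ hx => hx.symm) (hv.mono fun _ hx => hx.symm)

variable [Fact (1 ≤ p)]

/-- The reflection as a continuous operator. -/
def reflectL : XSpace p (Jp ⊕ Jm) →L[ℂ] XSpace p (Jp ⊕ Jm) where
  toLinearMap := reflect p
  cont := by
    refine (PiLp.continuousLinearEquiv p ℂ
      (fun _ : Jp ⊕ Jm => Lp ℂ p unitVol)).symm.continuous.comp (continuous_pi fun j => ?_)
    rcases j with i | i
    · exact (PiLp.proj (𝕜 := ℂ) p (fun _ : Jp ⊕ Jm => Lp ℂ p unitVol) (Sum.inl i)).continuous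
    · exact (Lp.compMeasurePreservingₗᵢ ℂ (fun x : ℝ => 1 - x)
        measurePreserving_reflect).continuous.comp
        (PiLp.proj (𝕜 := ℂ) p (fun _ : Jp ⊕ Jm => Lp ℂ p unitVol) (Sum.inr i)).continuous

variable {p}

theorem reflectL_apply (f : XSpace p (Jp ⊕ Jm)) : reflectL p f = reflect p f := rfl

/-- Conjugation of an operator by the reflection. -/
def conj (S : XSpace p (Jp ⊕ Jm) →L[ℂ] XSpace p (Jp ⊕ Jm)) :
    XSpace p (Jp ⊕ Jm) →L[ℂ] XSpace p (Jp ⊕ Jm) :=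
  (reflectL p).comp (S.comp (reflectL p))

theorem conj_apply (S : XSpace p (Jp ⊕ Jm) →L[ℂ] XSpace p (Jp ⊕ Jm)) (f : XSpace p (Jp ⊕ Jm)) :
    conj S f = reflect p (S (reflect p f)) := rfl

theorem conj_comp (S R : XSpace p (Jp ⊕ Jm) →L[ℂ] XSpace p (Jp ⊕ Jm)) :
    (conj S).comp (conj R) = conj (S.comp R) := by
  ext1 f
  simp only [ContinuousLinearMap.comp_apply, conj_apply, reflect_reflect]

theorem conj_id : conj (ContinuousLinearMap.id ℂ (XSpace p (Jp ⊕ Jm))) =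
    ContinuousLinearMap.id ℂ _ := by
  ext1 f
  simp only [ContinuousLinearMap.id_apply, conj_apply, reflect_reflect]

theorem conj_zero : conj (0 : XSpace p (Jp ⊕ Jm) →L[ℂ] XSpace p (Jp ⊕ Jm)) = 0 := by
  ext1 f
  simp only [zero_apply, conj_apply, map_zero]

theorem conj_injective :
    Function.Injective (conj : (XSpace p (Jp ⊕ Jm) →L[ℂ] XSpace p (Jp ⊕ Jm)) → _) := by
  intro S R h
  ext1 f
  have := congrArg (fun A => reflect p (A (reflect p f))) h
  simpa only [conj_apply, reflect_reflect] using this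

variable [Fintype Jp] [Fintype Jm]

theorem conj_add (S R : XSpace p (Jp ⊕ Jm) →L[ℂ] XSpace p (Jp ⊕ Jm)) :
    conj (S + R) = conj S + conj R := by
  ext1 f
  simp only [add_apply, conj_apply, map_add]

theorem norm_conj_le (S : XSpace p (Jp ⊕ Jm) →L[ℂ] XSpace p (Jp ⊕ Jm)) :
    ‖conj S‖ ≤ ‖reflectL (Jp := Jp) (Jm := Jm) p‖ * ‖reflectL (Jp := Jp) (Jm := Jm) p‖ * ‖S‖ := by
  refine (ContinuousLinearMap.opNorm_comp_le _ _).trans ?_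
  rw [mul_assoc, mul_comm _ ‖S‖]
  gcongr
  exact ContinuousLinearMap.opNorm_comp_le _ _

theorem isC0Semigroup_conj {T : ℝ≥0 → XSpace p (Jp ⊕ Jm) →L[ℂ] XSpace p (Jp ⊕ Jm)}
    (hT : IsC0Semigroup T) : IsC0Semigroup fun t => conj (T t) where
  map_zero := by rw [hT.map_zero, conj_id]
  map_add s t := by rw [hT.map_add, conj_comp]
  continuous f := (reflectL p).continuous.comp (hT.continuous (reflect p f))

theorem isGenPair_conj {T : ℝ≥0 → XSpace p (Jp ⊕ Jm) →L[ℂ] XSpace p (Jp ⊕ Jm)}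
    {f g : XSpace p (Jp ⊕ Jm)} (h : IsGenPair T (reflect p f) (reflect p g)) :
    IsGenPair (fun t => conj (T t)) f g := by
  have h1 := ((reflectL p).continuous.tendsto _).comp h
  rw [reflectL_apply, reflect_reflect] at h1
  refine h1.congr fun r => ?_
  simp only [Function.comp, map_smul, map_sub, reflectL_apply, reflect_reflect, conj_apply]

theorem isGenPair_conj_iff {T : ℝ≥0 → XSpace p (Jp ⊕ Jm) →L[ℂ] XSpace p (Jp ⊕ Jm)}
    {f g : XSpace p (Jp ⊕ Jm)} :
    IsGenPair (fun t => conj (T t)) f g ↔ IsGenPair T (reflect p f) (reflect p g) := by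
  refine ⟨fun h => ?_, isGenPair_conj⟩
  have h1 := isGenPair_conj (T := fun t => conj (T t)) (f := reflect p f) (g := reflect p g)
    (by rwa [reflect_reflect, reflect_reflect])
  have e : (fun t => conj (conj (T t))) = T := by
    funext t
    ext1 f
    simp only [conj_apply, reflect_reflect]
  rwa [e] at h1

/-- Reflecting a component changes the sign of its derivative and exchanges its boundary values,
which turns both the equation and the boundary condition into the one-directional form. -/
theorem transportGraph_iff (B : Matrix (Jp ⊕ Jm) (Jp ⊕ Jm) ℂ) (f g : XSpace p (Jp ⊕ Jm)) :
    transportGraph p B f g ↔ IntegratedEq B (reflect p f) (reflect p g) := by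
  rw [integratedEq_iff]
  have hf := coeFn_reflect_inr p f
  have hg := coeFn_reflect_inr p g
  have hf' : ∀ i, ∀ᵐ x ∂unitVol, f (Sum.inr i) x = reflect p f (Sum.inr i) (1 - x) := fun i => by
    filter_upwards [ae_unitVol_reflect (hf i)] with x hx
    rw [hx, sub_sub_cancel]
  have hg' : ∀ i, ∀ᵐ x ∂unitVol, g (Sum.inr i) x = reflect p g (Sum.inr i) (1 - x) := fun i => by
    filter_upwards [ae_unitVol_reflect (hg i)] with x hx
    rw [hx, sub_sub_cancel]
  constructor
  · rintro ⟨h1, h2, U, hU, hB⟩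
    refine ⟨fun j => ?_, fun j => Sum.elim (fun i => U (Sum.inl i))
      (fun i x => U (Sum.inr i) (1 - x)) j, fun j => ?_, ?_⟩
    · rcases j with i | i
      · exact h1 i
      · exact (h2 i).reflect_congr (hf i) ((hg i).mono fun x hx => by rw [Pi.neg_apply, hx])
    · rcases j with i | i
      · exact hU (Sum.inl i)
      · exact (hU (Sum.inr i)).reflect (hf i)
    · have e0 : (fun j => Sum.elim (fun i => U (Sum.inl i))
          (fun i x => U (Sum.inr i) (1 - x)) j 0) =
          Sum.elim (fun i => U (Sum.inl i) 0) (fun i => U (Sum.inr i) 1) := by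
        funext j; rcases j with i | i <;> simp
      have e1 : (fun j => Sum.elim (fun i => U (Sum.inl i))
          (fun i x => U (Sum.inr i) (1 - x)) j 1) =
          Sum.elim (fun i => U (Sum.inl i) 1) (fun i => U (Sum.inr i) 0) := by
        funext j; rcases j with i | i <;> simp
      rw [e0, e1, hB]
  · rintro ⟨h, U, hU, hB⟩
    refine ⟨fun i => h (Sum.inl i), fun i => (h (Sum.inr i)).reflect_congr (hf' i)
      ((hg' i).mono fun x hx => by rw [Pi.neg_apply, neg_neg, hx]),
      fun j => Sum.elim (fun i => U (Sum.inl i)) (fun i x => U (Sum.inr i) (1 - x)) j,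
      fun j => ?_, ?_⟩
    · rcases j with i | i
      · exact hU (Sum.inl i)
      · exact (hU (Sum.inr i)).reflect (hf' i)
    · have e0 : Sum.elim (fun i : Jp => U (Sum.inl i) 0) (fun i : Jm => U (Sum.inr i) (1 - 1)) =
          fun j => U j 0 := by
        funext j; rcases j with i | i <;> simp
      have e1 : Sum.elim (fun i : Jp => U (Sum.inl i) 1) (fun i : Jm => U (Sum.inr i) (1 - 0)) =
          fun j => U j 1 := by
        funext j; rcases j with i | i <;> simp
      simp only [Sum.elim_inl, Sum.elim_inr]
      rw [e0, e1, hB]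

variable [DecidableEq Jp] [DecidableEq Jm]

theorem generates_conj_transport (hp : p ≠ ⊤) (B : Matrix (Jp ⊕ Jm) (Jp ⊕ Jm) ℂ) :
    Generates (transportGraph p B) fun t => conj (transport p B t) := by
  refine ⟨isC0Semigroup_conj (isC0Semigroup_transport p B hp), fun f g => ?_⟩
  rw [transportGraph_iff, ← isGenPair_transport_iff hp]
  exact isGenPair_conj_iff.symm

theorem eq_conj_transport (hp : p ≠ ⊤) (B : Matrix (Jp ⊕ Jm) (Jp ⊕ Jm) ℂ)
    {G : ℝ≥0 → XSpace p (Jp ⊕ Jm) →L[ℂ] XSpace p (Jp ⊕ Jm)}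
    (hG : Generates (transportGraph p B) G) : G = fun t => conj (transport p B t) := by
  have hN := generates_conj_transport hp B
  exact hG.1.eq_of_isGenPair_imp hN.1 fun f g h => (hG.2 f g).1 ((hN.2 f g).2 h)

end Reflect

/-! ### Constant matrices, decay, and possible periods -/

section Projections

variable {p : ℝ≥0∞} [Fact (1 ≤ p)] {J : Type*} [Fintype J]

variable (p) in
/-- The action of a matrix as a continuous operator. -/
abbrev matOp (M : Matrix J J ℂ) : XSpace p J →L[ℂ] XSpace p J :=
  tens p M (ContinuousLinearMap.id ℂ _)

theorem matAct_eq_matOp (M : Matrix J J ℂ) : matAct p M = (matOp p M).toLinearMap := by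
  refine LinearMap.ext fun f => PiLp.ext fun i => ?_
  change _ = tens p M _ f i
  rw [tens_apply]
  rfl

theorem matOp_mul (M N : Matrix J J ℂ) : (matOp p M).comp (matOp p N) = matOp p (M * N) := by
  rw [matOp, matOp, tens_mul, ContinuousLinearMap.id_comp]

theorem coeFn_matOp (M : Matrix J J ℂ) (f : XSpace p J) :
    ∀ᵐ x ∂unitVol, ∀ i, matOp p M f i x = ∑ j, M i j * f j x :=
  ae_all_iff.2 fun i => coeFn_tens M _ f i

variable [DecidableEq J]

theorem matOp_one : matOp p (1 : Matrix J J ℂ) = ContinuousLinearMap.id ℂ _ := tens_one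

theorem matOp_comp_transport {B Q : Matrix J J ℂ} (h : Commute Q B) (t : ℝ≥0) :
    (matOp p Q).comp (transport p B t) = (transport p B t).comp (matOp p Q) := by
  rw [transport, ContinuousLinearMap.comp_finsetSum, ContinuousLinearMap.finsetSum_comp]
  refine Finset.sum_congr rfl fun n _ => ?_
  rw [matOp, tens_mul, tens_mul, (h.pow_right n).eq, ContinuousLinearMap.id_comp,
    ContinuousLinearMap.comp_id]

theorem transport_natCast (B : Matrix J J ℂ) (n : ℕ) :
    transport p B (n : ℝ≥0) = matOp p (B ^ n) := by
  induction n with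
  | zero => rw [Nat.cast_zero, transport_zero, pow_zero, matOp_one]
  | succ n ih =>
    have h1 : transport p B 1 = matOp p B := by
      rw [transport_eq_sum_range p B (N := 2) (by norm_num)]
      simp [Finset.sum_range_succ, shift_zero, shift_eq_zero, tens_zero_right]
    rw [Nat.cast_succ, transport_add, ih, h1, matOp_mul, pow_succ]

/-- Splitting t into its integer part n and a remainder r ≤ 1 gives Q T(t) = (Q B^n) T(r): the first
factor tends to 0 and the second is bounded. -/
theorem tendsto_matOp_comp_transport (hp : p ≠ ⊤) {B Q : Matrix J J ℂ}
    (h : Tendsto (fun n : ℕ => Q * B ^ n) atTop (𝓝 0)) :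
    Tendsto (fun t => (matOp p Q).comp (transport p B t)) atTop (𝓝 0) := by
  obtain ⟨K, hK0, hK⟩ := exists_norm_tens_le (p := p) (J := J)
  obtain ⟨C, hC⟩ := (isC0Semigroup_transport p B hp).exists_bound 1
  have h1 : Tendsto (fun n : ℕ => K * (∑ i, ∑ j, ‖(Q * B ^ n) i j‖) *
      ‖ContinuousLinearMap.id ℂ (Lp ℂ p unitVol)‖ * C) atTop (𝓝 0) := by
    have h2 : Tendsto (fun n : ℕ => ∑ i, ∑ j, ‖(Q * B ^ n) i j‖) atTop (𝓝 0) := by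
      have : Continuous fun M : Matrix J J ℂ => ∑ i, ∑ j, ‖M i j‖ := by fun_prop
      have h3 := (this.tendsto 0).comp h
      simp only [Matrix.zero_apply, norm_zero, Finset.sum_const_zero] at h3
      exact h3
    simpa using ((h2.const_mul K).mul_const _).mul_const C
  refine squeeze_zero_norm (fun t => ?_) (h1.comp tendsto_nat_floor_atTop)
  have ht : t = (⌊t⌋₊ : ℝ≥0) + (t - ⌊t⌋₊) := (add_tsub_cancel_of_le (Nat.floor_le zero_le)).symm
  have ht1 : t - (⌊t⌋₊ : ℝ≥0) ≤ 1 := by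
    rw [tsub_le_iff_left]; exact (Nat.lt_floor_add_one t).le
  have e : (matOp p Q).comp (transport p B t) =
      (matOp p (Q * B ^ ⌊t⌋₊)).comp (transport p B (t - ⌊t⌋₊)) := by
    conv_lhs => rw [ht, transport_add, transport_natCast]
    rw [← ContinuousLinearMap.comp_assoc, matOp_mul]
  rw [e]
  refine (ContinuousLinearMap.opNorm_comp_le _ _).trans ?_
  exact mul_le_mul (hK _ _) (hC _ ht1) (norm_nonneg _) (by positivity)

/-- If the transport semigroup fixes a nontrivial `v ⊗ id` at time `T`, where `v` is an eigenvector
for a unimodular eigenvalue, then `T` is an integer that annihilates the eigenvalue. -/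
theorem exists_nat_of_transport_fixed {B : Matrix J J ℂ} {v : J → ℂ} (hv : v ≠ 0) {μ : ℂ}
    (hμ : ‖μ‖ = 1) (hB : B.mulVec v = μ • v) {T : ℝ≥0}
    (hT : ∀ f : XSpace p J, (∀ M : Matrix J J ℂ, M.mulVec v = v → matOp p M f = f) →
      transport p B T f = f) :
    ∃ n : ℕ, T = n ∧ μ ^ n = 1 := by
  have hmem : MemLp (fun x : ℝ => (x : ℂ)) p unitVol := by
    refine MemLp.of_bound (Complex.continuous_ofReal.aestronglyMeasurable) 1 ?_
    filter_upwards [ae_unitVol_mem] with x hx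
    rw [Complex.norm_real, Real.norm_of_nonneg hx.1.le]
    exact hx.2.le
  let h : Lp ℂ p unitVol := hmem.toLp _
  have hh : ∀ᵐ x ∂unitVol, h x = (x : ℂ) := hmem.coeFn_toLp
  -- The test function is v ⊗ x: positivity and injectivity of x on (0,1) allow the foot point to be
  -- recovered from the modulus of the value.
  let f : XSpace p J := WithLp.toLp p fun i => v i • h
  have hf : ∀ᵐ x ∂unitVol, ∀ i, f i x = v i * x := by
    refine ae_all_iff.2 fun i => ?_
    filter_upwards [Lp.coeFn_smul (v i) h, hh] with x h1 h2
    change (v i • h : Lp ℂ p unitVol) x = _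
    rw [h1, Pi.smul_apply, h2, smul_eq_mul]
  have hfix := hT f fun M hM => PiLp.ext fun i => by
    rw [tens_apply]
    change ∑ j, M i j • v j • h = v i • h
    simp_rw [smul_smul]
    rw [← Finset.sum_smul]
    congr 1
    exact congrFun hM i
  obtain ⟨i, hi⟩ := Function.ne_iff.1 hv
  have hpow : ∀ n : ℕ, (B ^ n).mulVec v = μ ^ n • v := by
    intro n
    induction n with
    | zero => simp
    | succ n ih => rw [pow_succ, ← Matrix.mulVec_mulVec, hB, Matrix.mulVec_smul, ih, smul_smul,
        pow_succ']
  have hsh := fun n : ℕ => ae_restrict_of_ae (s := Ioo (0 : ℝ) 1)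
    (ae_unitVol_add hf ((n : ℝ) - T))
  obtain ⟨x, hx, hx1, hx2, hx3, n, hn⟩ := (ae_unitVol_mem.and ((transport_apply_ae p B T f).and
    (hf.and ((ae_all_iff.2 hsh).and (exists_branch_ae T))))).exists
  have h1 := hx1 n hn i
  rw [hfix, hx2 i] at h1
  simp_rw [hx3 n hn, ← mul_assoc] at h1
  rw [← Finset.sum_mul] at h1
  have h2 : ∑ j, (B ^ n) i j * v j = μ ^ n * v i := congrFun (hpow n) i
  rw [h2, mul_comm (μ ^ n), mul_assoc] at h1
  have h3 : (x : ℂ) = μ ^ n * ((x + ((n : ℝ) - T) : ℝ) : ℂ) := mul_left_cancel₀ hi h1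
  -- Since |μ| = 1, moduli give that the foot point is x itself, so T = n; afterwards x cancels and
  -- μ^n = 1 remains.
  have h4 : x = x + ((n : ℝ) - T) := by
    have := congrArg norm h3
    rwa [norm_mul, norm_pow, hμ, one_pow, one_mul, Complex.norm_real, Complex.norm_real,
      Real.norm_of_nonneg hx.1.le, Real.norm_of_nonneg hn.1.le] at this
  have h5 : (T : ℝ) = n := by linarith
  refine ⟨n, by exact_mod_cast h5, ?_⟩
  rw [← h4] at h3
  have hx0 : (x : ℂ) ≠ 0 := by exact_mod_cast hx.1.ne'
  exact mul_right_cancel₀ hx0 (by rw [one_mul]; exact h3.symm)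

end Projections

/-! ### Ranges of complementary projections -/

section Complement

variable {E : Type*} [NormedAddCommGroup E] [NormedSpace ℂ E] {S R : E →L[ℂ] E}

theorem isCompl_range_of_add_eq_id (hadd : S + R = ContinuousLinearMap.id ℂ E)
    (hSR : S.comp R = 0) (hRS : R.comp S = 0) :
    IsCompl (LinearMap.range S.toLinearMap) (LinearMap.range R.toLinearMap) := by
  have hid : ∀ x, S x + R x = x := fun x => DFunLike.congr_fun hadd x
  constructor
  · rw [Submodule.disjoint_def]
    rintro x ⟨a, rfl⟩ ⟨b, hb⟩
    have h1 : R (S a) = 0 := DFunLike.congr_fun hRS a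
    have h2 : S (S a) = 0 := by
      change R b = S a at hb
      rw [← hb]
      exact DFunLike.congr_fun hSR b
    have := hid (S a)
    rw [h1, h2, add_zero] at this
    exact this.symm
  · rw [codisjoint_iff, eq_top_iff]
    intro x _
    rw [← hid x]
    exact Submodule.add_mem_sup ⟨x, rfl⟩ ⟨x, rfl⟩

/-- The range of S is the kernel of the continuous operator R. -/
theorem isClosed_range_of_add_eq_id (hadd : S + R = ContinuousLinearMap.id ℂ E)
    (hRS : R.comp S = 0) : IsClosed (LinearMap.range S.toLinearMap : Set E) := by
  have : (LinearMap.range S.toLinearMap : Set E) = {x | R x = 0} := by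
    ext x
    constructor
    · rintro ⟨a, rfl⟩
      exact DFunLike.congr_fun hRS a
    · intro hx
      have hid : S x + R x = x := DFunLike.congr_fun hadd x
      rw [show R x = 0 from hx, add_zero] at hid
      exact ⟨x, hid⟩
  rw [this]
  exact isClosed_eq R.continuous continuous_const

end Complement

/-! ### The block formula in the original orientation -/

section BlockFormula

variable {Jp Jm : Type*} [Fintype Jp] [Fintype Jm]

theorem sum_blocks_mulVec_inl {d : ℕ} (C : Fin d → Matrix (Jp ⊕ Jm) (Jp ⊕ Jm) ℂ)
    (w : Jp ⊕ Jm → ℂ) (i : Jp) :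
    (∑ l, ((C l).toBlocks₁₁.mulVec (fun a => w (Sum.inl a)) +
      (C l).toBlocks₁₂.mulVec (fun b => w (Sum.inr b)))) i =
      ((∑ l, C l).mulVec w) (Sum.inl i) := by
  rw [Matrix.sum_mulVec, Finset.sum_apply, Finset.sum_apply]
  refine Finset.sum_congr rfl fun l _ => ?_
  simp only [Pi.add_apply, Matrix.mulVec, dotProduct, Fintype.sum_sum_type]
  rfl

theorem sum_blocks_mulVec_inr {d : ℕ} (C : Fin d → Matrix (Jp ⊕ Jm) (Jp ⊕ Jm) ℂ)
    (w : Jp ⊕ Jm → ℂ) (i : Jm) :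
    (∑ l, ((C l).toBlocks₂₁.mulVec (fun a => w (Sum.inl a)) +
      (C l).toBlocks₂₂.mulVec (fun b => w (Sum.inr b)))) i =
      ((∑ l, C l).mulVec w) (Sum.inr i) := by
  rw [Matrix.sum_mulVec, Finset.sum_apply, Finset.sum_apply]
  refine Finset.sum_congr rfl fun l _ => ?_
  simp only [Pi.add_apply, Matrix.mulVec, dotProduct, Fintype.sum_sum_type]
  rfl

variable {p : ℝ≥0∞} [Fact (1 ≤ p)] [DecidableEq Jp] [DecidableEq Jm]

/-- Both formulas are the characteristic formula for the reflected system, read at x for the `Jp`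
components and at 1 - x for the `Jm` components. The inequalities on t say that the foot point of
branch n lies in (0,1). -/
theorem hasBlockFormula_conj {d : ℕ} {B Q : Matrix (Jp ⊕ Jm) (Jp ⊕ Jm) ℂ}
    {C : ℕ → Fin d → Matrix (Jp ⊕ Jm) (Jp ⊕ Jm) ℂ} (hC : ∀ n, ∑ l, C n l = Q * B ^ n) :
    HasBlockFormula (p := p) C fun t => conj ((matOp p Q).comp (transport p B t)) := by
  intro t f n
  set h := reflect p f with hh
  set F := matOp p Q (transport p B t h) with hF
  let w : ℝ → Jp ⊕ Jm → ℂ := fun z => Sum.elim (fun a => f (Sum.inl a) z)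
    (fun b => f (Sum.inr b) (1 - z))
  have hw : ∀ᵐ z ∂unitVol, ∀ j, h j z = w z j := by
    refine ae_all_iff.2 fun j => ?_
    rcases j with a | b
    · exact Eventually.of_forall fun z => rfl
    · exact coeFn_reflect_inr p f b
  have hFy : ∀ᵐ y ∂unitVol, y + ((n : ℝ) - t) ∈ Ioo (0 : ℝ) 1 → ∀ i,
      F i y = ((∑ l, C n l).mulVec (w (y + ((n : ℝ) - t)))) i := by
    filter_upwards [coeFn_matOp Q (transport p B t h), transport_apply_ae p B t h,
      ae_restrict_of_ae (ae_unitVol_add hw ((n : ℝ) - t))] with y h1 h2 h3 hy i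
    rw [hF, h1, hC, ← Matrix.mulVec_mulVec]
    refine Finset.sum_congr rfl fun k _ => ?_
    rw [h2 n hy]
    simp_rw [h3 hy]
    rfl
  have hinr : ∀ᵐ x ∂unitVol, ∀ i, reflect p F (Sum.inr i) x = F (Sum.inr i) (1 - x) :=
    ae_all_iff.2 fun i => coeFn_reflect_inr p F i
  filter_upwards [hFy, ae_unitVol_reflect hFy, hinr] with x h1 h2 h3
  constructor
  · rintro ⟨ha, hb⟩
    have hx : x + ((n : ℝ) - t) ∈ Ioo (0 : ℝ) 1 := ⟨by linarith, by linarith⟩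
    funext i
    have e1 : (n : ℝ) - t + x = x + ((n : ℝ) - t) := by ring
    have e2 : 1 - (n : ℝ) + t - x = 1 - (x + ((n : ℝ) - t)) := by ring
    rw [e1, e2]
    exact (h1 hx (Sum.inl i)).trans (sum_blocks_mulVec_inl (C n) (w (x + ((n : ℝ) - t))) i).symm
  · rintro ⟨ha, hb⟩
    have hx : 1 - x + ((n : ℝ) - t) ∈ Ioo (0 : ℝ) 1 := ⟨by linarith, by linarith⟩
    funext i
    have e1 : 1 - (t : ℝ) + n - x = 1 - x + ((n : ℝ) - t) := by ring
    have e2 : (t : ℝ) - n + x = 1 - (1 - x + ((n : ℝ) - t)) := by ring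
    rw [e1, e2]
    exact (h3 i).trans ((h2 hx (Sum.inr i)).trans
      (sum_blocks_mulVec_inr (C n) (w (1 - x + ((n : ℝ) - t))) i).symm)

end BlockFormula

/-! ### Sums of spectral projections -/

section SpectralSums

variable {J : Type*} [Fintype J] [DecidableEq J] {B : Matrix J J ℂ} {ι : Type*} {lam : ι → ℂ}

theorem commute_sum_specProj (s : Finset ι) : Commute (∑ j ∈ s, specProj B (lam j)) B :=
  Commute.sum_left _ _ _ fun j _ => commute_specProj B (lam j)

theorem sum_specProj_mul_sum_of_disjoint (hinj : Function.Injective lam) {s t : Finset ι}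
    (h : Disjoint s t) :
    (∑ j ∈ s, specProj B (lam j)) * (∑ j ∈ t, specProj B (lam j)) = 0 := by
  rw [Finset.sum_mul_sum]
  refine Finset.sum_eq_zero fun i hi => Finset.sum_eq_zero fun j hj => ?_
  refine specProj_mul_of_ne B fun e => ?_
  have := hinj e
  subst this
  exact Finset.disjoint_left.1 h hi hj

theorem exists_eigenvector {μ : ℂ} (hμ : μ ∈ spectrum ℂ B) :
    ∃ v : J → ℂ, v ≠ 0 ∧ B.mulVec v = μ • v ∧ v ∈ genEig B μ := by
  rw [← Matrix.spectrum_toLin'] at hμ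
  obtain ⟨v, hv⟩ := (Module.End.hasEigenvalue_iff_mem_spectrum.2 hμ).exists_hasEigenvector
  refine ⟨v, hv.2, ?_, Module.End.eigenspace_le_maxGenEigenspace hv.1⟩
  simpa using hv.apply_eq_smul

end SpectralSums

end NetworkTransport

end

theorem theorem4 {Jp Jm : Type*} [Fintype Jp] [Fintype Jm] [DecidableEq Jp] [DecidableEq Jm]
    (p : ℝ≥0∞) [Fact (1 ≤ p)] (hp : p ≠ ⊤)
    (B : Matrix (Jp ⊕ Jm) (Jp ⊕ Jm) ℂ)
    (k d : ℕ) (hd : d ≤ k) (lam : Fin k → ℂ) (hinj : Function.Injective lam)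
    (hspec : Set.range lam = spectrum ℂ B)
    (hstab : ∀ j : Fin k, d ≤ (j : ℕ) → ‖lam j‖ < 1)
    (Z1 Z2 : Submodule ℂ (XSpace p (Jp ⊕ Jm)))
    (hZ1 : Z1 = reflectedRange p
      (∑ j ∈ Finset.univ.filter (fun j : Fin k => (j : ℕ) < d), specProj B (lam j)))
    (hZ2 : Z2 = reflectedRange p
      (∑ j ∈ Finset.univ.filter (fun j : Fin k => d ≤ (j : ℕ)), specProj B (lam j))) :
    -- the transport operator with boundary matrix `B` generates a semigroup
    (∃ G : ℝ≥0 → XSpace p (Jp ⊕ Jm) →L[ℂ] XSpace p (Jp ⊕ Jm),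
      Generates (transportGraph p B) G) ∧
    ∀ G : ℝ≥0 → XSpace p (Jp ⊕ Jm) →L[ℂ] XSpace p (Jp ⊕ Jm),
      Generates (transportGraph p B) G →
      -- the splitting into closed invariant subspaces
      IsCompl Z1 Z2 ∧ IsClosed (Z1 : Set (XSpace p (Jp ⊕ Jm))) ∧
      IsClosed (Z2 : Set (XSpace p (Jp ⊕ Jm))) ∧
      (∀ t, ∀ f ∈ Z1, G t f ∈ Z1) ∧ (∀ t, ∀ f ∈ Z2, G t f ∈ Z2) ∧
      ∃ G1 : ℝ≥0 → XSpace p (Jp ⊕ Jm) →L[ℂ]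
          XSpace p (Jp ⊕ Jm),
        -- `G1` is the part of `G` in `Z1`, extended by `0` on `Z2`, and a semigroup
        (∀ t, ∀ f ∈ Z1, G1 t f = G t f) ∧ (∀ t, ∀ f ∈ Z2, G1 t f = 0) ∧
        (∀ s t, G1 (s + t) = (G1 s).comp (G1 t)) ∧
        -- convergence in operator norm
        Tendsto (fun t => G t - G1 t) atTop (𝓝 0) ∧
        -- the explicit formula
        HasBlockFormula (fun n (j : Fin d) =>
          powPart B (lam (Fin.castLE hd j)) n *
            specProj B (lam (Fin.castLE hd j))) G1 ∧
        -- the periodic case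
        (1 ≤ d →
          (∀ j : Fin d,
            IsSemisimpleEigenvalue B (lam (Fin.castLE hd j)) ∧
            lam (Fin.castLE hd j) = Complex.exp (2 * Real.pi * Complex.I * j / d)) →
          IsLeast {T : ℝ≥0 | 0 < T ∧ ∀ t, G1 (t + T) = G1 t} d ∧
          HasBlockFormula (fun n (j : Fin d) =>
            Complex.exp (2 * Real.pi * Complex.I * j * n / d) •
              specProj B (lam (Fin.castLE hd j))) G1) := by
  refine ⟨⟨_, generates_conj_transport hp B⟩, fun G hG => ?_⟩
  -- By uniqueness G is the explicit semigroup, so everything below is a computation with it.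
  obtain rfl := eq_conj_transport hp B hG
  set s1 := Finset.univ.filter (fun j : Fin k => (j : ℕ) < d) with hs1
  set s2 := Finset.univ.filter (fun j : Fin k => d ≤ (j : ℕ)) with hs2
  set P1 := ∑ j ∈ s1, specProj B (lam j) with hP1
  set P2 := ∑ j ∈ s2, specProj B (lam j) with hP2
  have hdisj : Disjoint s1 s2 := by
    rw [Finset.disjoint_left]
    intro j h1 h2
    simp only [hs1, hs2, Finset.mem_filter, Finset.mem_univ, true_and] at h1 h2
    omega
  have hunion : s1 ∪ s2 = Finset.univ := by
    ext j
    simp only [hs1, hs2, Finset.mem_union, Finset.mem_filter, Finset.mem_univ, true_and, iff_true]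
    omega
  have hsum : P1 + P2 = 1 := by
    rw [hP1, hP2, ← Finset.sum_union hdisj, hunion, sum_specProj B hinj hspec]
  have h12 : P1 * P2 = 0 := sum_specProj_mul_sum_of_disjoint hinj hdisj
  have h21 : P2 * P1 = 0 := sum_specProj_mul_sum_of_disjoint hinj hdisj.symm
  have h11 : P1 * P1 = P1 := by
    have := congrArg (P1 * ·) hsum
    simpa only [mul_add, h12, add_zero, mul_one] using this
  have hc1 : Commute P1 B := commute_sum_specProj s1
  have hc2 : Commute P2 B := commute_sum_specProj s2
  have hP1fin : P1 = ∑ j : Fin d, specProj B (lam (Fin.castLE hd j)) := by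
    rw [hP1]
    symm
    refine Finset.sum_bij (fun j _ => Fin.castLE hd j) ?_ ?_ ?_ ?_
    · intro j _
      simp [hs1]
    · intro i _ j _ h
      exact Fin.castLE_injective hd h
    · intro j hj
      simp only [hs1, Finset.mem_filter, Finset.mem_univ, true_and] at hj
      exact ⟨⟨j, hj⟩, Finset.mem_univ _, rfl⟩
    · intro j _
      rfl
  have hP1pow : ∀ n, P1 * B ^ n = ∑ j : Fin d, B ^ n * specProj B (lam (Fin.castLE hd j)) := by
    intro n
    rw [(hc1.pow_right n).eq, hP1fin, Finset.mul_sum]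
  set Q1 : XSpace p (Jp ⊕ Jm) →L[ℂ] XSpace p (Jp ⊕ Jm) := conj (matOp p P1) with hQ1
  set Q2 : XSpace p (Jp ⊕ Jm) →L[ℂ] XSpace p (Jp ⊕ Jm) := conj (matOp p P2) with hQ2
  have hZ1' : Z1 = LinearMap.range Q1.toLinearMap := by
    rw [hZ1, reflectedRange, matAct_eq_matOp]; rfl
  have hZ2' : Z2 = LinearMap.range Q2.toLinearMap := by
    rw [hZ2, reflectedRange, matAct_eq_matOp]; rfl
  have hQadd : Q1 + Q2 = ContinuousLinearMap.id ℂ _ := by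
    rw [hQ1, hQ2, ← conj_add, ← tens_add_left, hsum, tens_one, conj_id]
  have hQmul : ∀ M N : Matrix (Jp ⊕ Jm) (Jp ⊕ Jm) ℂ,
      (conj (matOp p M)).comp (conj (matOp p N)) = conj (matOp p (M * N)) := fun M N => by
    rw [conj_comp, matOp_mul]
  have hQ12 : Q1.comp Q2 = 0 := by rw [hQ1, hQ2, hQmul, h12, matOp, tens_zero_left, conj_zero]
  have hQ21 : Q2.comp Q1 = 0 := by rw [hQ1, hQ2, hQmul, h21, matOp, tens_zero_left, conj_zero]
  have hQ11 : Q1.comp Q1 = Q1 := by rw [hQ1, hQmul, h11]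
  set N : ℝ≥0 → XSpace p (Jp ⊕ Jm) →L[ℂ] XSpace p (Jp ⊕ Jm) :=
    fun t => conj (transport p B t) with hN
  have hNadd : ∀ s t, N (s + t) = (N s).comp (N t) := fun s t => by
    simp only [hN]
    rw [conj_comp, transport_add]
  have hcomm : ∀ {Q : Matrix (Jp ⊕ Jm) (Jp ⊕ Jm) ℂ}, Commute Q B → ∀ t,
      (conj (matOp p Q)).comp (N t) = (N t).comp (conj (matOp p Q)) := fun hQ t => by
    simp only [hN]
    rw [conj_comp, conj_comp, matOp_comp_transport hQ]
  have hcQ1 : ∀ t f, Q1 (N t f) = N t (Q1 f) := fun t f => DFunLike.congr_fun (hcomm hc1 t) f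
  have hcQ2 : ∀ t f, Q2 (N t f) = N t (Q2 f) := fun t f => DFunLike.congr_fun (hcomm hc2 t) f
  have hQ11a : ∀ f, Q1 (Q1 f) = Q1 f := fun f => DFunLike.congr_fun hQ11 f
  have hQ12a : ∀ f, Q1 (Q2 f) = 0 := fun f => DFunLike.congr_fun hQ12 f
  have hG1 : ∀ t, Q1.comp (N t) = conj ((matOp p P1).comp (transport p B t)) := fun t => by
    rw [hQ1, hN, conj_comp]
  refine ⟨?_, ?_, ?_, ?_, ?_, fun t => Q1.comp (N t), ?_, ?_, ?_, ?_, ?_, ?_⟩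
  · rw [hZ1', hZ2']
    exact isCompl_range_of_add_eq_id hQadd hQ12 hQ21
  · rw [hZ1']
    exact isClosed_range_of_add_eq_id hQadd hQ21
  · rw [hZ2']
    exact isClosed_range_of_add_eq_id (by rw [add_comm, hQadd]) hQ12
  · rw [hZ1']
    rintro t _ ⟨a, rfl⟩
    exact ⟨N t a, hcQ1 t a⟩
  · rw [hZ2']
    rintro t _ ⟨a, rfl⟩
    exact ⟨N t a, hcQ2 t a⟩
  · rw [hZ1']
    rintro t _ ⟨a, rfl⟩
    change Q1 (N t (Q1 a)) = N t (Q1 a)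
    rw [hcQ1, hQ11a]
  · rw [hZ2']
    rintro t _ ⟨a, rfl⟩
    change Q1 (N t (Q2 a)) = 0
    rw [hcQ1, hQ12a, map_zero]
  · intro s t
    ext1 f
    simp only [ContinuousLinearMap.comp_apply, hNadd]
    rw [← hcQ1 s (N t f), hQ11a]
  -- As the two projections add up to the identity, the difference is the part of the semigroup
  -- governed by the eigenvalues inside the unit disc.
  · have e : (fun t => N t - Q1.comp (N t)) =
        fun t => conj ((matOp p P2).comp (transport p B t)) := by
      funext t
      rw [← conj_comp, ← hQ2, sub_eq_iff_eq_add, ← ContinuousLinearMap.add_comp, add_comm, hQadd,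
        ContinuousLinearMap.id_comp]
    rw [e]
    have hdecay : Tendsto (fun n : ℕ => P2 * B ^ n) atTop (𝓝 0) := by
      have h0 : Tendsto (fun n : ℕ => ∑ j ∈ s2, B ^ n * specProj B (lam j)) atTop
          (𝓝 (∑ _j ∈ s2, 0)) := by
        refine tendsto_finsetSum _ fun j hj => tendsto_pow_mul_specProj B (hstab j ?_)
        simpa [hs2] using hj
      rw [Finset.sum_const_zero] at h0
      refine h0.congr fun n => ?_
      rw [(hc2.pow_right n).eq, hP2, Finset.mul_sum]
    have h1 := (tendsto_zero_iff_norm_tendsto_zero.1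
      (tendsto_matOp_comp_transport (p := p) hp hdecay)).const_mul
        (‖reflectL (Jp := Jp) (Jm := Jm) p‖ * ‖reflectL (Jp := Jp) (Jm := Jm) p‖)
    rw [mul_zero] at h1
    exact squeeze_zero_norm (fun t => norm_conj_le _) h1
  · simp_rw [hG1]
    refine hasBlockFormula_conj fun n => ?_
    rw [hP1pow]
    exact Finset.sum_congr rfl fun j _ => (pow_mul_specProj B _ n).symm
  · intro hd1 hper
    have hpow : ∀ (n : ℕ) (j : Fin d), B ^ n * specProj B (lam (Fin.castLE hd j)) =
        Complex.exp (2 * Real.pi * Complex.I * j * n / d) •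
          specProj B (lam (Fin.castLE hd j)) := by
      intro n j
      rw [pow_mul_specProj_of_semisimple B (hper j).1, (hper j).2, ← Complex.exp_nat_mul]
      congr 2
      ring
    have hd0 : (d : ℂ) ≠ 0 := by exact_mod_cast (by omega : d ≠ 0)
    refine ⟨⟨⟨by exact_mod_cast hd1, fun t => ?_⟩, ?_⟩, ?_⟩
    · have hPd : P1 * B ^ d = P1 := by
        rw [hP1pow, hP1fin]
        refine Finset.sum_congr rfl fun j _ => ?_
        rw [hpow, mul_div_assoc, div_self hd0, mul_one,
          show (2 * Real.pi * Complex.I * (j : ℕ) : ℂ) = (j : ℕ) * (2 * Real.pi * Complex.I) by ring,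
          Complex.exp_nat_mul_two_pi_mul_I, one_smul]
      have hNd : N d = conj (matOp p (B ^ d)) := by
        simp only [hN]
        rw [transport_natCast]
      change Q1.comp (N (t + d)) = Q1.comp (N t)
      rw [add_comm, hNadd, hNd, ← ContinuousLinearMap.comp_assoc, hQ1, hQmul, hPd]
    · rintro T ⟨hT0, hT⟩
      -- The index 1 carries the primitive root exp(2πi/d); reduction modulo d covers d = 1, where
      -- the index is 0 and the eigenvalue is 1.
      let j1 : Fin d := ⟨1 % d, Nat.mod_lt _ hd1⟩
      set μ := lam (Fin.castLE hd j1) with hμ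
      have hprim : IsPrimitiveRoot μ d := by
        rw [hμ, (hper j1).2]
        rcases Nat.lt_or_ge 1 d with h | h
        · have e : (j1 : ℕ) = 1 := Nat.mod_eq_of_lt h
          rw [e, Nat.cast_one, mul_one]
          exact Complex.isPrimitiveRoot_exp d (by omega)
        · have e : d = 1 := by omega
          have e' : (j1 : ℕ) = 0 := by simp only [j1, e]
          rw [e', e]
          simp
      obtain ⟨v, hv0, hBv, hv⟩ := exists_eigenvector (B := B) (μ := μ)
        (hspec ▸ Set.mem_range_self _)
      have hP1v : P1.mulVec v = v := by
        rw [hP1fin, Matrix.sum_mulVec, Finset.sum_eq_single j1]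
        · exact specProj_mulVec_self B hv
        · intro j _ hj
          exact specProj_mulVec_of_ne B
            (fun e => hj (Fin.castLE_injective hd (hinj e)).symm) hv
        · simp
      have hT' : (matOp p P1).comp (transport p B T) = matOp p P1 := by
        -- Periodicity at t = 0 already says P1 T(T) = P1, which fixes every function on which P1
        -- acts as the identity.
        have h0 := hT 0
        beta_reduce at h0
        rw [zero_add, hG1, hG1, transport_zero, ContinuousLinearMap.comp_id] at h0
        exact conj_injective h0
      obtain ⟨n, hn, hμn⟩ := exists_nat_of_transport_fixed (p := p) (T := T) hv0
        (hprim.norm'_eq_one (by omega)) hBv fun f hf => by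
          have h1 : matOp p P1 (transport p B T f) = matOp p P1 f := DFunLike.congr_fun hT' f
          have h2 : matOp p P1 (transport p B T f) = transport p B T (matOp p P1 f) :=
            DFunLike.congr_fun (matOp_comp_transport hc1 T) f
          rwa [h2, hf P1 hP1v] at h1
      rw [hn] at hT0 ⊢
      exact_mod_cast Nat.le_of_dvd (by exact_mod_cast hT0) (hprim.dvd_of_pow_eq_one n hμn)
    · simp_rw [hG1]
      refine hasBlockFormula_conj fun n => ?_
      rw [hP1pow]
      exact Finset.sum_congr rfl fun j _ => (hpow n j).symm
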